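/- Let $\mathcal A$ be the set of differential functions, i.e. of the smooth real functions of $t$, $x$, $u$ and finitely many derivatives of $u$, where $t,x,u,u_t,u_x,u_{tt},u_{tx},u_{xx},\dots$ are regarded as independent real variables (coordinates of the infinite jet space); a differential function has order at most $n$ if it depends only on $t$, $x$, $u$ and the derivatives of $u$ of order at most $n$. Let $D_t,D_x$ be the total derivatives and $\mathcal E_u=\sum_{i,j\ge 0}(-D_t)^i(-D_x)^j\,\partial/\partial u_{t^ix^j}$ the Euler–Lagrange operator. Consider the equation $F=0$ with $$F=u_t-u_{txx}+3u^2u_x-uu_{xxx}-2u_xu_{xx}.$$ A conserved current of this equation is a pair $C=(C^0,C^1)\in\mathcal A^2$ whose divergence $\operatorname{Div}C=D_tC^0+D_xC^1$ vanishes on the solutions, i.e. at every point of the infinite jet space at which $F$ and all its total derivatives $D_t^iD_x^jF$ vanish; its order is the maximum of the orders of $C^0$ and $C^1$. A pair in $\mathcal A^2$ is trivial if its divergence vanishes identically on the whole jet space. Put $$C_1=\left(u-u_{xx},\; u^3-\tfrac12u_x^2-uu_{xx}\right),\qquad C_2=\left(\tfrac{u^2+u_x^2}{2},\; \tfrac34u^4-uu_{tx}-u^2u_{xx}\right),$$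 and let $C_3$ be the pair with density $\tfrac14u^4+\tfrac12uu_x^2$ and flux $$\tfrac12u^6+\tfrac18u_x^4-\tfrac12u_t^2-uu_tu_x-\tfrac12u^3u_x^2+\tfrac12uu_x^2u_{xx}+\tfrac12u_x^2u_{tx}+\tfrac12u_{tx}^2+\tfrac12u^2u_{xx}^2-u^4u_{xx}+uu_{xx}u_{tx}-u^3u_{tx}.$$ **Theorem 3.2.** (a) $C_1,C_2,C_3$ are conserved currents of $F=0$ of order at most two. (b) A pair $C\in\mathcal A^2$ of order at most two is a conserved current of $F=0$ if and only if there are real constants $c_1,c_2,c_3$ such that $C-(c_1C_1+c_2C_2+c_3C_3)$ is trivial. For all such $C$ and $c_1,c_2,c_3$, $$\operatorname{Div}C=\Bigl(c_1+c_2u+c_3\bigl(u^3-\tfrac12u_x^2-u_{tx}-uu_{xx}\bigr)\Bigr)F .$$ (c) A differential function $\varphi$ of order at most two satisfies $\mathcal E_u(\varphi F)=0$ identically if and only if $$\varphi=c_1+c_2u+c_3\left(u^3-\tfrac12u_x^2-u_{tx}-uu_{xx}\right)$$ for some real constants $c_1,c_2,c_3$. -/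

import Mathlib

open scoped ContDiff

namespace CHCurrents

/-- Coordinates of the infinite jet space of functions `u = u(t, x)`: the independent variables
`t`, `x`, and, for `i j : ℕ`, the coordinate `u i j` standing for `∂ᵢ₊ⱼ u / ∂tⁱ ∂xʲ`
(so that `u 0 0` stands for the dependent variable itself). -/
inductive JetCoord where
  | t : JetCoord
  | x : JetCoord
  | u : ℕ → ℕ → JetCoord
  deriving DecidableEq

open JetCoord

/-- A point of the infinite jet space: a real value for every coordinate. -/
abbrev Jet : Type := JetCoord → ℝ

/-- The coordinates `t`, `x` and `u i j` with `i + j ≤ n`. -/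
def coordsUpTo (n : ℕ) : Finset JetCoord :=
  {t, x} ∪ (((Finset.range (n + 1)) ×ˢ (Finset.range (n + 1))).filter
    (fun p => p.1 + p.2 ≤ n)).image (fun p => u p.1 p.2)

/-- `f` is a differential function of order at most `n`: a smooth function of `t`, `x`, `u` and the
derivatives of `u` up to order `n`. -/
def HasOrderLE (n : ℕ) (f : Jet → ℝ) : Prop :=
  ∃ g : (coordsUpTo n → ℝ) → ℝ, ContDiff ℝ ∞ g ∧ ∀ z : Jet, f z = g (fun k => z k)

/-- `f` is a differential function: a smooth function of `t`, `x`, `u` and finitely many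
derivatives of `u`. -/
def IsDifferentialFunction (f : Jet → ℝ) : Prop := ∃ n : ℕ, HasOrderLE n f

/-- The partial derivative of `f` with respect to the jet coordinate `k`. -/
noncomputable def partialD (k : JetCoord) (f : Jet → ℝ) : Jet → ℝ :=
  fun z => deriv (fun s : ℝ => f (Function.update z k s)) (z k)

/-- The total derivative `D_t = ∂/∂t + ∑ u_{(i+1) j} ∂/∂u_{i j}`; for a differential function only
finitely many terms of the sum are non-zero. -/
noncomputable def Dt (f : Jet → ℝ) : Jet → ℝ :=
  fun z => partialD t f z + ∑ᶠ p : ℕ × ℕ, z (u (p.1 + 1) p.2) * partialD (u p.1 p.2) f z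

/-- The total derivative `D_x = ∂/∂x + ∑ u_{i (j+1)} ∂/∂u_{i j}`. -/
noncomputable def Dx (f : Jet → ℝ) : Jet → ℝ :=
  fun z => partialD x f z + ∑ᶠ p : ℕ × ℕ, z (u p.1 (p.2 + 1)) * partialD (u p.1 p.2) f z

/-- The Euler-Lagrange operator `E_u = ∑_{i,j} (-D_t)^i (-D_x)^j ∂/∂u_{i j}`. -/
noncomputable def euler (f : Jet → ℝ) : Jet → ℝ :=
  fun z => ∑ᶠ p : ℕ × ℕ,
    ((fun g => -Dt g)^[p.1] ((fun g => -Dx g)^[p.2] (partialD (u p.1 p.2) f))) z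

/-- A pair `(C⁰, C¹)` of functions on the jet space. -/
abbrev Current : Type := (Jet → ℝ) × (Jet → ℝ)

/-- The total divergence `D_t C⁰ + D_x C¹`. -/
noncomputable def totalDiv (C : Current) : Jet → ℝ := Dt C.1 + Dx C.2

/-- The order of the current, i.e. the maximum of the orders of its two components, is
at most `n`. -/
def Current.HasOrderLE (n : ℕ) (C : Current) : Prop :=
  CHCurrents.HasOrderLE n C.1 ∧ CHCurrents.HasOrderLE n C.2

/-- The infinite jet `z` lies on the solutions of the equation `F = 0`: the equation and all its
differential consequences `D_tⁱ D_xʲ F = 0` hold at `z`, i.e. the Taylor series with coefficients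
given by `z` is a formal solution. -/
def OnSolutions (F : Jet → ℝ) (z : Jet) : Prop :=
  ∀ i j : ℕ, (Dt^[i] (Dx^[j] F)) z = 0

/-- `C` is a conserved current of the equation `F = 0`: a pair of differential functions whose
total divergence vanishes identically on the solutions of the equation. -/
def IsConservedCurrent (F : Jet → ℝ) (C : Current) : Prop :=
  IsDifferentialFunction C.1 ∧ IsDifferentialFunction C.2 ∧
    ∀ z : Jet, OnSolutions F z → totalDiv C z = 0

/-- `C` is a trivial current: a pair of differential functions whose total divergence vanishes
identically, i.e. at all jets, whether or not they come from solutions of an equation. -/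
def IsTrivialCurrent (C : Current) : Prop :=
  IsDifferentialFunction C.1 ∧ IsDifferentialFunction C.2 ∧ ∀ z : Jet, totalDiv C z = 0

/-- `F = u_t - u_txx - u u_xxx - 2 u_x u_xx + 3 u² u_x`. -/
def eqF : Jet → ℝ := fun z =>
  z (u 1 0) - z (u 1 2) - z (u 0 0) * z (u 0 3) - 2 * z (u 0 1) * z (u 0 2)
    + 3 * z (u 0 0) ^ 2 * z (u 0 1)

/-- `(u - u_xx, u³ - u_x²/2 - u u_xx)`. -/
noncomputable def current1 : Current :=
  (fun z => z (u 0 0) - z (u 0 2),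
   fun z => z (u 0 0) ^ 3 - 1 / 2 * z (u 0 1) ^ 2 - z (u 0 0) * z (u 0 2))

/-- `((u² + u_x²)/2, 3u⁴/4 - u u_tx - u² u_xx)`. -/
noncomputable def current2 : Current :=
  (fun z => (z (u 0 0) ^ 2 + z (u 0 1) ^ 2) / 2,
   fun z => 3 / 4 * z (u 0 0) ^ 4 - z (u 0 0) * z (u 1 1) - z (u 0 0) ^ 2 * z (u 0 2))

/-- The current with density `u⁴/4 + u u_x²/2` and flux
`u⁶/2 + u_x⁴/8 - u_t²/2 - u u_t u_x - u³ u_x²/2 + u u_x² u_xx/2 + u_x² u_tx/2 + u_tx²/2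
  + u² u_xx²/2 - u⁴ u_xx + u u_xx u_tx - u³ u_tx`. -/
noncomputable def current3 : Current :=
  (fun z => 1 / 4 * z (u 0 0) ^ 4 + 1 / 2 * z (u 0 0) * z (u 0 1) ^ 2,
   fun z => 1 / 2 * z (u 0 0) ^ 6 + 1 / 8 * z (u 0 1) ^ 4 - 1 / 2 * z (u 1 0) ^ 2
     - z (u 0 0) * z (u 1 0) * z (u 0 1) - 1 / 2 * z (u 0 0) ^ 3 * z (u 0 1) ^ 2
     + 1 / 2 * z (u 0 0) * z (u 0 1) ^ 2 * z (u 0 2)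
     + 1 / 2 * z (u 0 1) ^ 2 * z (u 1 1) + 1 / 2 * z (u 1 1) ^ 2
     + 1 / 2 * z (u 0 0) ^ 2 * z (u 0 2) ^ 2 - z (u 0 0) ^ 4 * z (u 0 2)
     + z (u 0 0) * z (u 0 2) * z (u 1 1) - z (u 0 0) ^ 3 * z (u 1 1))

/-- The function `c₁ + c₂ u + c₃ (u³ - u_x²/2 - u_tx - u u_xx)`. -/
noncomputable def charac (c₁ c₂ c₃ : ℝ) : Jet → ℝ := fun z =>
  c₁ + c₂ * z (u 0 0)
    + c₃ * (z (u 0 0) ^ 3 - 1 / 2 * z (u 0 1) ^ 2 - z (u 1 1) - z (u 0 0) * z (u 0 2))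

end CHCurrents

set_option linter.unusedSimpArgs false

namespace CHCurrents
open JetCoord

/-! Write `v, w` for `u_t, u_x`, write `p, q, r` for `u_tt, u_tx, u_xx`, and put `F = Q - u_txx - u
u_xxx` with `Q` of order two.

From currents to characteristics: every jet with `F = 0` agrees up to order three with a jet on the
solutions (`solutionJet_eq`), because `D_t^i D_x^j F = 0` can be solved for `u_{i+1,j+2}`. If `C =
(A, B)` has order two, `Div C` is affine in `u_txx`. Moving `u_txx` until `F = 0` therefore shows
that a conserved current satisfies `Div C = φ F` with `φ = -(A_r + B_q)` (`div_eq_mul_eqDF`).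
Euler's operator kills divergences (`euler_totalDiv`), so `E_u(φ F) = 0`, and (b) reduces to (c).
Conversely, direct computation shows that the divergences of the three currents are `1`, `u` and `u³
- w²/2 - q - ur` times `F`.

Determining `φ`: the derivatives of `E_u(φ F) = 0` in the five fourth-order coordinates give
equations of order three, and comparing third-order terms there leaves equations on the second-order
jet space (`second_order_equations`). Brackets of the vector fields in these equations show that
`φ_p` and `φ_qq` depend on `t` only. What remains is `E_u(φ F)` restricted to jets whose coordinates
of order at least three vanish (`eulerTwo`). Its `p`-derivative forces `φ_p = φ_qq = 0`. This gives
`2φ = c(2(q + ur) + w²) - c_x(v + uw) + g` with `c(t,x)` and `g(t,x,u)` (`exists_ansatz`).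
Substituting this into `eulerTwo` and reading off coefficients makes `c` constant and `g` a cubic in
`u` with constant coefficients. -/

/-! ### Functions of finite order and their partial derivatives -/

theorem mem_coordsUpTo_u {n i j : ℕ} : u i j ∈ coordsUpTo n ↔ i + j ≤ n := by
  simp only [coordsUpTo, Finset.mem_union, Finset.mem_insert, Finset.mem_singleton, reduceCtorEq,
    or_self, false_or, Finset.mem_image, Finset.mem_filter, Finset.mem_product, Finset.mem_range,
    Prod.exists, u.injEq]
  constructor
  · rintro ⟨a, b, h, rfl, rfl⟩
    exact h.2
  · intro h
    exact ⟨i, j, ⟨⟨by omega, by omega⟩, h⟩, rfl, rfl⟩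

theorem t_mem_coordsUpTo (n : ℕ) : t ∈ coordsUpTo n := by simp [coordsUpTo]

theorem x_mem_coordsUpTo (n : ℕ) : x ∈ coordsUpTo n := by simp [coordsUpTo]

theorem coordsUpTo_mono {m n : ℕ} (h : m ≤ n) : coordsUpTo m ⊆ coordsUpTo n := by
  rintro (_ | _ | ⟨i, j⟩) hk
  · exact t_mem_coordsUpTo n
  · exact x_mem_coordsUpTo n
  · rw [mem_coordsUpTo_u] at hk ⊢
    omega

theorem exists_mem_coordsUpTo (k : JetCoord) : ∃ n, k ∈ coordsUpTo n := by
  rcases k with (_ | _ | ⟨i, j⟩)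
  · exact ⟨0, t_mem_coordsUpTo 0⟩
  · exact ⟨0, x_mem_coordsUpTo 0⟩
  · exact ⟨i + j, mem_coordsUpTo_u.2 le_rfl⟩

/-- The values of a jet at the coordinates of order at most `n`. -/
def restr (n : ℕ) (z : Jet) : coordsUpTo n → ℝ := fun k => z k

theorem HasOrderLE.congr_jet {n : ℕ} {f : Jet → ℝ} (hf : HasOrderLE n f) {z z' : Jet}
    (h : ∀ k ∈ coordsUpTo n, z k = z' k) : f z = f z' := by
  obtain ⟨g, -, hg⟩ := hf
  rw [hg, hg]
  congr 1
  ext k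
  exact h k k.2

theorem HasOrderLE.mono {m n : ℕ} (h : m ≤ n) {f : Jet → ℝ} (hf : HasOrderLE m f) :
    HasOrderLE n f := by
  obtain ⟨g, hg, hgf⟩ := hf
  refine ⟨fun y => g (fun k => y ⟨k, coordsUpTo_mono h k.2⟩), ?_, hgf⟩
  exact hg.comp (contDiff_pi.2 fun k => contDiff_apply ℝ ℝ _)

theorem HasOrderLE.const (n : ℕ) (c : ℝ) : HasOrderLE n (fun _ => c) :=
  ⟨fun _ => c, contDiff_const, fun _ => rfl⟩

theorem HasOrderLE.coord {n : ℕ} {k : JetCoord} (hk : k ∈ coordsUpTo n) :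
    HasOrderLE n (fun z => z k) :=
  ⟨fun y => y ⟨k, hk⟩, contDiff_apply ℝ ℝ _, fun _ => rfl⟩

theorem HasOrderLE.add {n : ℕ} {f g : Jet → ℝ} (hf : HasOrderLE n f) (hg : HasOrderLE n g) :
    HasOrderLE n (f + g) := by
  obtain ⟨a, ha, hfa⟩ := hf
  obtain ⟨b, hb, hgb⟩ := hg
  exact ⟨fun y => a y + b y, ha.add hb, fun z => by simp [hfa, hgb]⟩

theorem HasOrderLE.mul {n : ℕ} {f g : Jet → ℝ} (hf : HasOrderLE n f) (hg : HasOrderLE n g) :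
    HasOrderLE n (f * g) := by
  obtain ⟨a, ha, hfa⟩ := hf
  obtain ⟨b, hb, hgb⟩ := hg
  exact ⟨fun y => a y * b y, ha.mul hb, fun z => by simp [hfa, hgb]⟩

theorem HasOrderLE.sum {n : ℕ} {ι : Type*} {s : Finset ι} {f : ι → Jet → ℝ}
    (hf : ∀ i ∈ s, HasOrderLE n (f i)) : HasOrderLE n (∑ i ∈ s, f i) := by
  classical
  induction s using Finset.induction_on with
  | empty => exact HasOrderLE.const n 0
  | insert a s ha ih =>
    rw [Finset.sum_insert ha]
    exact (hf a (by simp)).add (ih fun i hi => hf i (by simp [hi]))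

theorem HasOrderLE.contDiff_line {n : ℕ} {f : Jet → ℝ} (hf : HasOrderLE n f) (z : Jet)
    (k : JetCoord) : ContDiff ℝ ∞ (fun s : ℝ => f (Function.update z k s)) := by
  obtain ⟨g, hg, hgf⟩ := hf
  simp only [hgf]
  refine hg.comp (contDiff_pi.2 fun l => ?_)
  by_cases h : (l : JetCoord) = k
  · simpa [Function.update_apply, h] using contDiff_fun_id
  · simpa [Function.update_apply, h] using contDiff_const

theorem HasOrderLE.differentiableAt_line {n : ℕ} {f : Jet → ℝ} (hf : HasOrderLE n f) (z : Jet)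
    (k : JetCoord) (s : ℝ) : DifferentiableAt ℝ (fun s : ℝ => f (Function.update z k s)) s :=
  (hf.contDiff_line z k).differentiable (by simp) s

theorem restr_update {n : ℕ} {k : JetCoord} (hk : k ∈ coordsUpTo n) (z : Jet) (s : ℝ) :
    restr n (Function.update z k s) = Function.update (restr n z) ⟨k, hk⟩ s := by
  ext l
  by_cases h : l = ⟨k, hk⟩
  · subst h
    simp [restr]
  · rw [Function.update_of_ne h]
    exact Function.update_of_ne (fun h' => h (Subtype.ext h')) _ _

/-- Reduces jet calculus to calculus in the finite-dimensional space of coordinates of order at most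
`n`. -/
theorem partialD_eq_fderiv {n : ℕ} {k : JetCoord} (hk : k ∈ coordsUpTo n) {f : Jet → ℝ}
    {g : (coordsUpTo n → ℝ) → ℝ} (hg : Differentiable ℝ g) (hgf : ∀ z, f z = g (restr n z))
    (z : Jet) : partialD k f z = fderiv ℝ g (restr n z) (Pi.single ⟨k, hk⟩ 1) := by
  unfold partialD
  simp only [hgf, restr_update hk]
  have h1 : HasDerivAt (Function.update (restr n z) ⟨k, hk⟩) (Pi.single ⟨k, hk⟩ (1 : ℝ)) (z k) :=
    hasDerivAt_update _ _ _
  have h2 : Function.update (restr n z) ⟨k, hk⟩ (z k) = restr n z :=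
    Function.update_eq_self (f := restr n z) ⟨k, hk⟩
  have h3 := (hg (Function.update (restr n z) ⟨k, hk⟩ (z k))).hasFDerivAt.comp_hasDerivAt (z k) h1
  rw [h2] at h3
  exact h3.deriv

theorem partialD_eq_zero {n : ℕ} {k : JetCoord} (hk : k ∉ coordsUpTo n) {f : Jet → ℝ}
    (hf : HasOrderLE n f) : partialD k f = 0 := by
  ext z
  have h : (fun s : ℝ => f (Function.update z k s)) = fun _ => f z := by
    ext s
    refine hf.congr_jet fun l hl => Function.update_of_ne (fun h => hk (by rwa [← h])) _ _
  simp [partialD, h]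

theorem contDiff_fderiv_apply {ι : Type*} [Fintype ι] {g : (ι → ℝ) → ℝ} (hg : ContDiff ℝ ∞ g)
    (v : ι → ℝ) : ContDiff ℝ ∞ (fun y => fderiv ℝ g y v) :=
  (hg.fderiv_right (by simp)).clm_apply contDiff_const

theorem HasOrderLE.partialD {n : ℕ} {f : Jet → ℝ} (hf : HasOrderLE n f) (k : JetCoord) :
    HasOrderLE n (partialD k f) := by
  by_cases hk : k ∈ coordsUpTo n
  · obtain ⟨g, hg, hgf⟩ := hf
    exact ⟨_, contDiff_fderiv_apply hg (Pi.single ⟨k, hk⟩ 1),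
      partialD_eq_fderiv hk (hg.differentiable (by simp)) hgf⟩
  · rw [partialD_eq_zero hk hf]
    exact HasOrderLE.const n 0

theorem partialD_comm {n : ℕ} {f : Jet → ℝ} (hf : HasOrderLE n f) (k l : JetCoord) :
    CHCurrents.partialD k (CHCurrents.partialD l f)
      = CHCurrents.partialD l (CHCurrents.partialD k f) := by
  obtain ⟨a, ha⟩ := exists_mem_coordsUpTo k
  obtain ⟨b, hb⟩ := exists_mem_coordsUpTo l
  obtain ⟨g, hg, hgf⟩ := hf.mono (show n ≤ n + a + b by omega)
  replace ha := coordsUpTo_mono (show a ≤ n + a + b by omega) ha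
  replace hb := coordsUpTo_mono (show b ≤ n + a + b by omega) hb
  have hd : Differentiable ℝ g := hg.differentiable (by simp)
  have hd' : Differentiable ℝ (fderiv ℝ g) := (hg.fderiv_right (m := ∞) (by simp)).differentiable
    (by simp)
  have key : ∀ {p q : JetCoord} (hp : p ∈ coordsUpTo (n + a + b)) (hq : q ∈ coordsUpTo (n + a + b))
      (z : Jet), CHCurrents.partialD p (CHCurrents.partialD q f) z
        = fderiv ℝ (fderiv ℝ g) (restr _ z) (Pi.single ⟨p, hp⟩ 1) (Pi.single ⟨q, hq⟩ 1) := by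
    intro p q hp hq z
    rw [partialD_eq_fderiv hp ((contDiff_fderiv_apply hg _).differentiable (by simp))
      (partialD_eq_fderiv hq hd hgf)]
    rw [fderiv_clm_apply (hd' _) (differentiableAt_const _)]
    simp
  ext z
  rw [key ha hb, key hb ha]
  have hs : IsSymmSndFDerivAt ℝ g (restr _ z) :=
    hg.contDiffAt.isSymmSndFDerivAt (by
    rw [minSmoothness_of_isRCLikeNormedField]
    exact WithTop.coe_le_coe.2 (le_top : (2 : ℕ∞) ≤ ⊤))
  exact hs.eq _ _

/-! ### The algebra of differential functions and its derivations -/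

/-- The common form of `Dt` (`k = t`, `a = 1`, `b = 0`) and `Dx` (`k = x`, `a = 0`, `b = 1`). -/
noncomputable def totalD (k : JetCoord) (a b : ℕ) (f : Jet → ℝ) : Jet → ℝ :=
  fun z => partialD k f z
    + ∑ᶠ p : ℕ × ℕ, z (u (p.1 + a) (p.2 + b)) * partialD (u p.1 p.2) f z

/-- The algebra of differential functions. -/
def diffFunSubalgebra : Subalgebra ℝ (Jet → ℝ) where
  carrier := {f | IsDifferentialFunction f}
  mul_mem' := by
    rintro f g ⟨m, hf⟩ ⟨n, hg⟩
    exact ⟨max m n, (hf.mono (le_max_left _ _)).mul (hg.mono (le_max_right _ _))⟩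
  add_mem' := by
    rintro f g ⟨m, hf⟩ ⟨n, hg⟩
    exact ⟨max m n, (hf.mono (le_max_left _ _)).add (hg.mono (le_max_right _ _))⟩
  algebraMap_mem' c := ⟨0, HasOrderLE.const 0 c⟩

/-- The type of differential functions. -/
def DiffFun : Type := diffFunSubalgebra

namespace DiffFun

noncomputable instance : CommRing DiffFun := inferInstanceAs (CommRing diffFunSubalgebra)

noncomputable instance : Algebra ℝ DiffFun := inferInstanceAs (Algebra ℝ diffFunSubalgebra)

/-- The function underlying a differential function. -/
def toFun (f : DiffFun) : Jet → ℝ := f.1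

/-- Evaluation of differential functions at a jet. -/
noncomputable def ev (z : Jet) : DiffFun →ₐ[ℝ] ℝ :=
  (Pi.evalAlgHom ℝ (fun _ : Jet => ℝ) z).comp diffFunSubalgebra.val

theorem toFun_apply (f : DiffFun) (z : Jet) : f.toFun z = ev z f := rfl

theorem ext_ev {f g : DiffFun} (h : ∀ z, ev z f = ev z g) : f = g :=
  Subtype.ext (funext h)

theorem toFun_injective : Function.Injective toFun := Subtype.val_injective

/-- The differential function given by a function and a bound on its order. -/
def mk {n : ℕ} (f : Jet → ℝ) (hf : HasOrderLE n f) : DiffFun := ⟨f, n, hf⟩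

@[simp] theorem toFun_mk {n : ℕ} (f : Jet → ℝ) (hf : HasOrderLE n f) : (mk f hf).toFun = f := rfl

theorem toFun_mul (f g : DiffFun) : (f * g).toFun = f.toFun * g.toFun := rfl

theorem toFun_neg (f : DiffFun) : (-f).toFun = -f.toFun := rfl

theorem toFun_zero : (0 : DiffFun).toFun = 0 := rfl

theorem toFun_sum {ι : Type*} (s : Finset ι) (f : ι → DiffFun) :
    (∑ i ∈ s, f i).toFun = ∑ i ∈ s, (f i).toFun := by
  ext z
  simp [toFun_apply]

theorem exists_order (f : DiffFun) : ∃ n, HasOrderLE n f.toFun := f.2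

/-- A jet coordinate as a differential function. -/
noncomputable def co (k : JetCoord) : DiffFun :=
  ⟨fun z => z k, let ⟨n, hn⟩ := exists_mem_coordsUpTo k; ⟨n, HasOrderLE.coord hn⟩⟩

@[simp] theorem ev_co (z : Jet) (k : JetCoord) : ev z (co k) = z k := rfl

/-- Partial derivatives as derivations of the algebra of differential functions. -/
noncomputable def pd (k : JetCoord) : Derivation ℝ DiffFun DiffFun :=
  Derivation.mk'
    { toFun := fun f => ⟨partialD k f.1, let ⟨n, hn⟩ := f.2; ⟨n, hn.partialD k⟩⟩
      map_add' := by
        rintro ⟨f, m, hf⟩ ⟨g, n, hg⟩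
        refine Subtype.ext (funext fun z => ?_)
        exact deriv_fun_add (hf.differentiableAt_line z k _) (hg.differentiableAt_line z k _)
      map_smul' := by
        rintro c ⟨f, m, hf⟩
        refine Subtype.ext (funext fun z => ?_)
        exact deriv_fun_const_smul c (hf.differentiableAt_line z k _) }
    (by
      rintro ⟨f, m, hf⟩ ⟨g, n, hg⟩
      refine Subtype.ext (funext fun z => ?_)
      have h := deriv_fun_mul (hf.differentiableAt_line z k (z k))
        (hg.differentiableAt_line z k (z k))
      simp only [Function.update_eq_self] at h
      refine h.trans ?_
      change _ = f z * partialD k g z + g z * partialD k f z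
      unfold partialD
      ring)

theorem toFun_pd (k : JetCoord) (f : DiffFun) : (pd k f).toFun = partialD k f.toFun := rfl

theorem pd_comm (k l : JetCoord) (f : DiffFun) : pd k (pd l f) = pd l (pd k f) := by
  obtain ⟨n, hn⟩ := f.2
  exact Subtype.ext (partialD_comm hn k l)

theorem pd_co (k l : JetCoord) : pd k (co l) = if k = l then 1 else 0 := by
  refine ext_ev fun z => ?_
  change deriv (fun s : ℝ => Function.update z k s l) (z k) = _
  by_cases h : k = l
  · subst h
    simp
  · have h' : l ≠ k := fun e => h e.symm
    simp [h, h']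

/-- The order of a differential function is at most `n`. -/
def Ord (n : ℕ) (f : DiffFun) : Prop := HasOrderLE n f.toFun

theorem Ord.pd {n : ℕ} {f : DiffFun} (hf : Ord n f) (k : JetCoord) : Ord n (pd k f) :=
  HasOrderLE.partialD hf k

theorem Ord.mono {m n : ℕ} (h : m ≤ n) {f : DiffFun} (hf : Ord m f) : Ord n f :=
  HasOrderLE.mono h hf

theorem Ord.add {n : ℕ} {f g : DiffFun} (hf : Ord n f) (hg : Ord n g) : Ord n (f + g) :=
  HasOrderLE.add hf hg

theorem Ord.mul {n : ℕ} {f g : DiffFun} (hf : Ord n f) (hg : Ord n g) : Ord n (f * g) :=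
  HasOrderLE.mul hf hg

theorem Ord.sum {n : ℕ} {ι : Type*} {s : Finset ι} {f : ι → DiffFun}
    (hf : ∀ i ∈ s, Ord n (f i)) : Ord n (∑ i ∈ s, f i) := by
  unfold Ord
  rw [toFun_sum]
  exact HasOrderLE.sum hf

theorem Ord.smul {n : ℕ} {f : DiffFun} (c : ℝ) (hf : Ord n f) : Ord n (c • f) :=
  HasOrderLE.mul (HasOrderLE.const n c) hf

theorem Ord.neg {n : ℕ} {f : DiffFun} (hf : Ord n f) : Ord n (-f) := by
  simpa using hf.smul (-1)

theorem Ord.sub {n : ℕ} {f g : DiffFun} (hf : Ord n f) (hg : Ord n g) : Ord n (f - g) := by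
  rw [sub_eq_add_neg]
  exact hf.add hg.neg

theorem ord_zero (n : ℕ) : Ord n 0 := HasOrderLE.const n 0

theorem ord_algebraMap (n : ℕ) (c : ℝ) : Ord n (algebraMap ℝ DiffFun c) := HasOrderLE.const n c

theorem ord_co {n : ℕ} {k : JetCoord} (hk : k ∈ coordsUpTo n) : Ord n (co k) := HasOrderLE.coord hk

theorem Ord.pd_eq_zero {n : ℕ} {f : DiffFun} (hf : Ord n f) {i j : ℕ} (h : n < i + j) :
    DiffFun.pd (u i j) f = 0 :=
  Subtype.ext (partialD_eq_zero (fun hk => by rw [mem_coordsUpTo_u] at hk; omega) hf)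

/-- A differential function with vanishing partial derivatives is constant. -/
theorem eq_algebraMap_of_pd_eq_zero {f : DiffFun} (hf : ∀ k, pd k f = 0) :
    ∃ c : ℝ, f = algebraMap ℝ DiffFun c := by
  obtain ⟨n, g, hg, hgf⟩ := f.2
  have hd : Differentiable ℝ g := hg.differentiable (by simp)
  have hsurj : ∀ y : coordsUpTo n → ℝ, ∃ z : Jet, restr n z = y := fun y =>
    ⟨fun k => if h : k ∈ coordsUpTo n then y ⟨k, h⟩ else 0, by ext k; simp [restr]⟩
  have h0 : ∀ y, fderiv ℝ g y = 0 := by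
    intro y
    obtain ⟨z, rfl⟩ := hsurj y
    refine ContinuousLinearMap.coe_injective (LinearMap.pi_ext' fun k => LinearMap.ext_ring ?_)
    have h := partialD_eq_fderiv k.2 hd hgf z
    have h' : partialD k.1 f.1 z = 0 := congrArg (fun f => toFun f z) (hf k.1)
    rw [h'] at h
    simpa using h.symm
  refine ⟨g 0, ext_ev fun z => ?_⟩
  rw [AlgHom.commutes]
  exact (hgf z).trans (is_const_of_fderiv_eq_zero hd h0 _ _)

/-- The total derivative, with its sum over all coordinates replaced by a finite one. -/
noncomputable def truncD (k : JetCoord) (a b N : ℕ) : Derivation ℝ DiffFun DiffFun :=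
  pd k + ∑ i ∈ Finset.range N, ∑ j ∈ Finset.range N, co (u (i + a) (j + b)) • pd (u i j)

theorem truncD_apply (k : JetCoord) (a b N : ℕ) (f : DiffFun) :
    truncD k a b N f = pd k f
      + ∑ i ∈ Finset.range N, ∑ j ∈ Finset.range N, co (u (i + a) (j + b)) * pd (u i j) f := by
  have h : ∀ (s : Finset ℕ) (D : ℕ → Derivation ℝ DiffFun DiffFun),
      (∑ i ∈ s, D i) f = ∑ i ∈ s, D i f := by
    intro s D
    induction s using Finset.induction_on with
    | empty => rfl
    | insert a s ha ih => rw [Finset.sum_insert ha, Finset.sum_insert ha, Derivation.add_apply, ih]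
  simp only [truncD, Derivation.add_apply, h, Derivation.smul_apply, smul_eq_mul]

/-- Any `N` above the order gives the same value, so identities involving several functions can be
checked at one common truncation. -/
theorem totalD_toFun (k : JetCoord) (a b : ℕ) {n : ℕ} {f : DiffFun} (hf : Ord n f) {N : ℕ}
    (hN : n < N) : totalD k a b f.toFun = (truncD k a b N f).toFun := by
  ext z
  have hs : (Function.support fun p : ℕ × ℕ =>
      z (u (p.1 + a) (p.2 + b)) * partialD (u p.1 p.2) f.toFun z) ⊆
      ((Finset.range N ×ˢ Finset.range N : Finset (ℕ × ℕ)) : Set (ℕ × ℕ)) := by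
    intro p hp
    rw [Function.mem_support] at hp
    by_contra h
    apply hp
    have h' : n < p.1 + p.2 := by
      simp only [Finset.coe_product, Finset.coe_range, Set.mem_prod, Set.mem_Iio] at h
      omega
    rw [← toFun_pd, hf.pd_eq_zero h']
    simp [toFun_zero]
  rw [totalD, finsum_eq_sum_of_support_subset _ hs, Finset.sum_product, truncD_apply, toFun_apply]
  simp only [map_add, map_sum, map_mul, ev_co]
  rfl

theorem ord_truncD (k : JetCoord) (a b : ℕ) (hab : a + b = 1) {n : ℕ}
    {f : DiffFun} (hf : Ord n f) (N : ℕ) : Ord (n + 1) (truncD k a b N f) := by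
  rw [truncD_apply]
  refine ((hf.pd k).mono (by omega)).add (Ord.sum fun i _ => Ord.sum fun j _ => ?_)
  by_cases h : n < i + j
  · rw [hf.pd_eq_zero h, mul_zero]
    exact ord_zero _
  · exact (ord_co (mem_coordsUpTo_u.2 (by omega))).mul ((hf.pd _).mono (by omega))

/-- Total derivatives as maps on the algebra of differential functions. -/
noncomputable def totalFun (k : JetCoord) (a b : ℕ) (f : DiffFun) : DiffFun :=
  ⟨totalD k a b f.toFun, by
    obtain ⟨n, hn⟩ := f.exists_order
    rw [totalD_toFun k a b (f := f) hn (Nat.lt_succ_self n)]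
    exact (truncD k a b (n + 1) f).exists_order⟩

theorem totalFun_eq (k : JetCoord) (a b : ℕ) {n : ℕ} {f : DiffFun} (hf : Ord n f) {N : ℕ}
    (hN : n < N) : totalFun k a b f = truncD k a b N f :=
  toFun_injective (totalD_toFun k a b hf hN)

/-- Total derivatives as derivations of the algebra of differential functions. -/
noncomputable def D (k : JetCoord) (a b : ℕ) : Derivation ℝ DiffFun DiffFun :=
  Derivation.mk'
    { toFun := totalFun k a b
      map_add' := by
        intro f g
        obtain ⟨m, hm⟩ := f.exists_order
        obtain ⟨n, hn⟩ := g.exists_order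
        rw [totalFun_eq k a b (f := f) hm (show m < m + n + 1 by omega),
          totalFun_eq k a b (f := g) hn (show n < m + n + 1 by omega),
          totalFun_eq k a b (f := f + g) (((show Ord m f from hm).mono (show m ≤ m + n by omega)).add
            ((show Ord n g from hn).mono (by omega))) (show m + n < m + n + 1 by omega), map_add]
      map_smul' := by
        intro c f
        obtain ⟨m, hm⟩ := f.exists_order
        rw [totalFun_eq k a b (f := f) hm (Nat.lt_succ_self m),
          totalFun_eq k a b (f := c • f) (Ord.smul c hm) (Nat.lt_succ_self m)]
        exact (truncD k a b (m + 1)).map_smul c f }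
    (by
      intro f g
      obtain ⟨m, hm⟩ := f.exists_order
      obtain ⟨n, hn⟩ := g.exists_order
      change totalFun k a b (f * g) = f • totalFun k a b g + g • totalFun k a b f
      rw [totalFun_eq k a b (f := f) hm (show m < m + n + 1 by omega),
        totalFun_eq k a b (f := g) hn (show n < m + n + 1 by omega),
        totalFun_eq k a b (f := f * g) (((show Ord m f from hm).mono (show m ≤ m + n by omega)).mul
          ((show Ord n g from hn).mono (by omega))) (show m + n < m + n + 1 by omega),
        Derivation.leibniz])

theorem D_eq_truncD (k : JetCoord) (a b : ℕ) {n : ℕ} {f : DiffFun} (hf : Ord n f) {N : ℕ}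
    (hN : n < N) : D k a b f = truncD k a b N f :=
  toFun_injective (totalD_toFun k a b hf hN)

/-- The total derivative with respect to `t`. -/
noncomputable abbrev T : Derivation ℝ DiffFun DiffFun := D t 1 0

/-- The total derivative with respect to `x`. -/
noncomputable abbrev X : Derivation ℝ DiffFun DiffFun := D x 0 1

theorem toFun_T (f : DiffFun) : (T f).toFun = Dt f.toFun := rfl

theorem toFun_X (f : DiffFun) : (X f).toFun = Dx f.toFun := rfl

theorem Ord.T {n : ℕ} {f : DiffFun} (hf : Ord n f) : Ord (n + 1) (T f) := by
  rw [D_eq_truncD t 1 0 hf (Nat.lt_succ_self n)]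
  exact ord_truncD _ 1 0 rfl hf _

theorem Ord.X {n : ℕ} {f : DiffFun} (hf : Ord n f) : Ord (n + 1) (X f) := by
  rw [D_eq_truncD x 0 1 hf (Nat.lt_succ_self n)]
  exact ord_truncD _ 0 1 rfl hf _

theorem D_co (k : JetCoord) (a b i j : ℕ) (hk : k ≠ u i j) :
    D k a b (co (u i j)) = co (u (i + a) (j + b)) := by
  have h : Ord (i + j) (co (u i j)) := ord_co (mem_coordsUpTo_u.2 le_rfl)
  rw [D_eq_truncD k a b h (Nat.lt_succ_self _), truncD_apply]
  simp only [pd_co, hk, if_false, zero_add, u.injEq, mul_ite, mul_one, mul_zero]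
  rw [Finset.sum_eq_single i, Finset.sum_eq_single j]
  · simp
  · intro l _ hl
    simp [hl]
  · intro h
    simp only [Finset.mem_range] at h
    omega
  · intro l _ hl
    simp [hl]
  · intro h
    simp only [Finset.mem_range] at h
    omega

@[simp] theorem T_co (i j : ℕ) : T (co (u i j)) = co (u (i + 1) j) :=
  D_co t 1 0 i j (by simp)

@[simp] theorem X_co (i j : ℕ) : X (co (u i j)) = co (u i (j + 1)) :=
  D_co x 0 1 i j (by simp)

/-! ### Commutators of partial and total derivatives -/

/-- The extra sum comes from differentiating the coefficients `u_{i+a,j+b}` of the total derivative.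
At most one of its terms survives: `[∂/∂u_{i+a,j+b}, D] = ∂/∂u_{ij}`. -/
theorem pd_D (l k : JetCoord) (a b : ℕ) {n : ℕ} {f : DiffFun} (hf : Ord n f) {N : ℕ}
    (hN : n < N) : pd l (D k a b f) = D k a b (pd l f)
      + ∑ i ∈ Finset.range N, ∑ j ∈ Finset.range N,
        if l = u (i + a) (j + b) then pd (u i j) f else 0 := by
  rw [D_eq_truncD k a b hf hN, D_eq_truncD k a b (hf.pd l) hN, truncD_apply, truncD_apply]
  simp only [map_add, map_sum, Derivation.leibniz, smul_eq_mul, Finset.sum_add_distrib, pd_co,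
    mul_ite, mul_one, mul_zero, pd_comm l]
  ring

theorem pd_D_of_forall_ne {l k : JetCoord} {a b : ℕ} (h : ∀ i j, l ≠ u (i + a) (j + b))
    (f : DiffFun) : pd l (D k a b f) = D k a b (pd l f) := by
  obtain ⟨n, hn⟩ := f.exists_order
  rw [pd_D l k a b (f := f) hn (Nat.lt_succ_self n)]
  simp [h]

theorem pd_D_add (k : JetCoord) (a b i j : ℕ) (f : DiffFun) :
    pd (u (i + a) (j + b)) (D k a b f) = D k a b (pd (u (i + a) (j + b)) f) + pd (u i j) f := by
  obtain ⟨n, hn⟩ := f.exists_order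
  rw [pd_D _ k a b (f := f) hn (show n < n + i + j + 1 by omega)]
  simp only [u.injEq, Nat.add_right_cancel_iff]
  rw [Finset.sum_eq_single i, Finset.sum_eq_single j]
  · simp
  · intro l _ hl
    simp [hl.symm]
  · intro h
    simp only [Finset.mem_range] at h
    omega
  · intro l _ hl
    simp [hl.symm]
  · intro h
    simp only [Finset.mem_range] at h
    omega

theorem pd_x_T (f : DiffFun) : pd x (T f) = T (pd x f) := pd_D_of_forall_ne (by simp) f

theorem pd_zero_T (j : ℕ) (f : DiffFun) : pd (u 0 j) (T f) = T (pd (u 0 j) f) :=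
  pd_D_of_forall_ne (by simp) f

theorem pd_zero_X (i : ℕ) (f : DiffFun) : pd (u i 0) (X f) = X (pd (u i 0) f) :=
  pd_D_of_forall_ne (by simp) f

theorem pd_succ_T (i j : ℕ) (f : DiffFun) :
    pd (u (i + 1) j) (T f) = T (pd (u (i + 1) j) f) + pd (u i j) f := pd_D_add t 1 0 i j f

theorem pd_succ_X (i j : ℕ) (f : DiffFun) :
    pd (u i (j + 1)) (X f) = X (pd (u i (j + 1)) f) + pd (u i j) f := pd_D_add x 0 1 i j f

theorem T_X_comm (f : DiffFun) : T (X f) = X (T f) := by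
  obtain ⟨n, hn⟩ := f.exists_order
  replace hn : Ord n f := hn
  -- The truncation `n + 2` serves both `f` and `T f`, the latter having order `n + 1`.
  rw [D_eq_truncD x 0 1 hn (show n < n + 1 + 1 by omega),
    D_eq_truncD x 0 1 hn.T (show n + 1 < n + 1 + 1 by omega), truncD_apply, truncD_apply]
  set M := n + 1 with hM
  have h0 : ∑ j ∈ Finset.range (M + 1), co (u 0 (j + 1)) * pd (u 0 j) (T f)
      = ∑ j ∈ Finset.range (M + 1), co (u 0 (j + 1)) * T (pd (u 0 j) f) := by
    simp only [pd_zero_T]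
  have h1 : ∀ i, ∑ j ∈ Finset.range (M + 1), co (u (i + 1) (j + 1)) * pd (u (i + 1) j) (T f)
      = ∑ j ∈ Finset.range (M + 1), co (u (i + 1) (j + 1)) * T (pd (u (i + 1) j) f)
        + ∑ j ∈ Finset.range (M + 1), co (u (i + 1) (j + 1)) * pd (u i j) f := by
    intro i
    simp only [pd_succ_T, mul_add, Finset.sum_add_distrib]
  -- Shifting the row index leaves the boundary row `i = M`, which vanishes because `M` exceeds the
  -- order of `f`.
  have h2 : ∑ j ∈ Finset.range (M + 1), co (u (M + 1) (j + 1)) * pd (u M j) f = 0 :=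
    Finset.sum_eq_zero fun j _ => by rw [hn.pd_eq_zero (by omega), mul_zero]
  simp only [map_add, map_sum, Derivation.leibniz, smul_eq_mul, add_zero, T_co, pd_x_T,
    Finset.sum_add_distrib]
  rw [Finset.sum_range_succ' (fun i => ∑ j ∈ Finset.range (M + 1),
    co (u i (j + 1)) * pd (u i j) (T f)), h0]
  simp only [h1, Finset.sum_add_distrib]
  rw [Finset.sum_range_succ' (fun i => ∑ j ∈ Finset.range (M + 1),
    co (u i (j + 1)) * T (pd (u i j) f))]
  rw [Finset.sum_range_succ (fun i => ∑ j ∈ Finset.range (M + 1),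
    pd (u i j) f * co (u (i + 1) (j + 1)))]
  simp only [mul_comm (pd _ f) (co _), h2]
  ring

/-! ### The Euler–Lagrange operator annihilates divergences -/

/-- The operator `-D_t` as a linear endomorphism. -/
noncomputable def negT : Module.End ℝ DiffFun := -T.toLinearMap

/-- The operator `-D_x` as a linear endomorphism. -/
noncomputable def negX : Module.End ℝ DiffFun := -X.toLinearMap

theorem negT_apply (f : DiffFun) : negT f = -T f := rfl

theorem negX_apply (f : DiffFun) : negX f = -X f := rfl

theorem commute_negT_negX : Commute negT negX := by
  refine LinearMap.ext fun f => ?_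
  simp only [Module.End.mul_apply, negT_apply, negX_apply, map_neg, neg_neg]
  exact T_X_comm f

/-- The Euler-Lagrange operator with its sum restricted to `i, j < N`. -/
noncomputable def eulerSum (N : ℕ) (f : DiffFun) : DiffFun :=
  ∑ i ∈ Finset.range N, ∑ j ∈ Finset.range N, (negT ^ i * negX ^ j) (pd (u i j) f)

theorem eulerSum_add (N : ℕ) (f g : DiffFun) :
    eulerSum N (f + g) = eulerSum N f + eulerSum N g := by
  simp only [eulerSum, map_add, Finset.sum_add_distrib]

theorem toFun_negT_pow_negX_pow (i j : ℕ) (f : DiffFun) :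
    ((negT ^ i * negX ^ j) f).toFun
      = (fun g => -Dt g)^[i] ((fun g => -Dx g)^[j] f.toFun) := by
  have hT : Function.Semiconj toFun (fun g => negT g) (fun g => -Dt g) := fun g => by
    simp only [negT_apply, toFun_neg, toFun_T]
  have hX : Function.Semiconj toFun (fun g => negX g) (fun g => -Dx g) := fun g => by
    simp only [negX_apply, toFun_neg, toFun_X]
  rw [Module.End.mul_apply, Module.End.pow_apply, Module.End.pow_apply]
  exact ((hT.iterate_right i) _).trans (congrArg _ ((hX.iterate_right j) _))

theorem euler_toFun {n : ℕ} {f : DiffFun} (hf : Ord n f) {N : ℕ} (hN : n < N) :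
    euler f.toFun = (eulerSum N f).toFun := by
  ext z
  have h : ∀ p : ℕ × ℕ, ((fun g => -Dt g)^[p.1] ((fun g => -Dx g)^[p.2]
      (partialD (u p.1 p.2) f.toFun))) z
        = ev z ((negT ^ p.1 * negX ^ p.2) (pd (u p.1 p.2) f)) := by
    intro p
    rw [← toFun_apply, toFun_negT_pow_negX_pow, toFun_pd]
  unfold euler
  simp only [h]
  rw [finsum_eq_sum_of_support_subset (s := Finset.range N ×ˢ Finset.range N),
    Finset.sum_product, toFun_apply, eulerSum]
  · simp only [map_sum]
  · intro p hp
    rw [Function.mem_support] at hp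
    by_contra h
    apply hp
    have h' : n < p.1 + p.2 := by
      simp only [Finset.coe_product, Finset.coe_range, Set.mem_prod, Set.mem_Iio] at h
      omega
    rw [hf.pd_eq_zero h', map_zero, map_zero]

/-- By the commutator formula each row is a difference of consecutive terms, so the sum over `i`
telescopes. The last term involves `∂f/∂u_{Mj}`, which is zero since `M` exceeds the order. -/
theorem eulerSum_T {n : ℕ} {f : DiffFun} (hf : Ord n f) {M : ℕ} (hM : n < M) :
    eulerSum (M + 1) (T f) = 0 := by
  have hz : ∀ j g, (negT ^ 0 * negX ^ j) (pd (u 0 j) (T g))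
      = -(negT ^ 1 * negX ^ j) (pd (u 0 j) g) := by
    intro j g
    rw [pd_zero_T, pow_zero, one_mul, pow_one, (commute_negT_negX.pow_right j).eq,
      Module.End.mul_apply, negT_apply, map_neg, neg_neg]
  have hs : ∀ i j g, (negT ^ (i + 1) * negX ^ j) (pd (u (i + 1) j) (T g))
      = (negT ^ (i + 1) * negX ^ j) (pd (u i j) g)
        - (negT ^ (i + 2) * negX ^ j) (pd (u (i + 1) j) g) := by
    intro i j g
    rw [pd_succ_T, map_add, pow_succ _ (i + 1), mul_assoc (negT ^ (i + 1)),
      (commute_negT_negX.pow_right j).eq, ← mul_assoc, Module.End.mul_apply _ negT, negT_apply,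
      map_neg]
    abel
  have hlast : ∑ j ∈ Finset.range (M + 1), (negT ^ (M + 1) * negX ^ j) (pd (u M j) f) = 0 :=
    Finset.sum_eq_zero fun j _ => by rw [hf.pd_eq_zero (by omega), map_zero]
  rw [eulerSum, Finset.sum_range_succ']
  simp only [hz, hs, Finset.sum_sub_distrib, Finset.sum_neg_distrib]
  have h := Finset.sum_range_succ' (fun i => ∑ j ∈ Finset.range (M + 1),
    (negT ^ (i + 1) * negX ^ j) (pd (u i j) f)) M
  rw [Finset.sum_range_succ, hlast, add_zero] at h
  rw [h]
  simp only [zero_add]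
  abel

theorem eulerSum_X {n : ℕ} {f : DiffFun} (hf : Ord n f) {M : ℕ} (hM : n < M) :
    eulerSum (M + 1) (X f) = 0 := by
  have hz : ∀ i g, (negT ^ i * negX ^ 0) (pd (u i 0) (X g))
      = -(negT ^ i * negX ^ 1) (pd (u i 0) g) := by
    intro i g
    rw [pd_zero_X, pow_zero, mul_one, pow_one, Module.End.mul_apply, negX_apply, map_neg, neg_neg]
  have hs : ∀ i j g, (negT ^ i * negX ^ (j + 1)) (pd (u i (j + 1)) (X g))
      = (negT ^ i * negX ^ (j + 1)) (pd (u i j) g)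
        - (negT ^ i * negX ^ (j + 2)) (pd (u i (j + 1)) g) := by
    intro i j g
    rw [pd_succ_X, map_add, pow_succ _ (j + 1), ← mul_assoc, Module.End.mul_apply _ negX,
      negX_apply, map_neg]
    abel
  rw [eulerSum]
  refine Finset.sum_eq_zero fun i _ => ?_
  rw [Finset.sum_range_succ']
  simp only [hz, hs, Finset.sum_sub_distrib]
  have h := Finset.sum_range_succ' (fun j => (negT ^ i * negX ^ (j + 1)) (pd (u i j) f)) M
  rw [Finset.sum_range_succ, hf.pd_eq_zero (show n < i + M by omega), map_zero, add_zero] at h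
  rw [h]
  simp only [zero_add]
  abel

/-- The Euler-Lagrange operator annihilates total divergences. -/
theorem euler_totalDiv (f g : DiffFun) : euler (T f + X g).toFun = 0 := by
  obtain ⟨m, hm⟩ := f.exists_order
  obtain ⟨n, hn⟩ := g.exists_order
  have hf : Ord (m + n) f := HasOrderLE.mono (by omega) hm
  have hg : Ord (m + n) g := HasOrderLE.mono (by omega) hn
  rw [euler_toFun (hf.T.add hg.X) (Nat.lt_succ_self _), eulerSum_add,
    eulerSum_T hf (Nat.lt_succ_self _), eulerSum_X hg (Nat.lt_succ_self _), add_zero]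
  rfl

/-! ### Second-order functions and restriction to second-order polynomial jets -/

theorem T_of_ord_two {f : DiffFun} (hf : Ord 2 f) :
    T f = pd t f + co (u 1 0) * pd (u 0 0) f + co (u 2 0) * pd (u 1 0) f
      + co (u 1 1) * pd (u 0 1) f + co (u 3 0) * pd (u 2 0) f + co (u 2 1) * pd (u 1 1) f
      + co (u 1 2) * pd (u 0 2) f := by
  rw [D_eq_truncD t 1 0 hf (show 2 < 3 by omega), truncD_apply]
  simp only [Finset.sum_range_succ, Finset.sum_range_zero, zero_add, add_zero, Nat.reduceAdd,
    hf.pd_eq_zero (show 2 < 1 + 2 by omega), hf.pd_eq_zero (show 2 < 2 + 1 by omega),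
    hf.pd_eq_zero (show 2 < 2 + 2 by omega), mul_zero]
  ring

theorem X_of_ord_two {f : DiffFun} (hf : Ord 2 f) :
    X f = pd x f + co (u 0 1) * pd (u 0 0) f + co (u 1 1) * pd (u 1 0) f
      + co (u 0 2) * pd (u 0 1) f + co (u 2 1) * pd (u 2 0) f + co (u 1 2) * pd (u 1 1) f
      + co (u 0 3) * pd (u 0 2) f := by
  rw [D_eq_truncD x 0 1 hf (show 2 < 3 by omega), truncD_apply]
  simp only [Finset.sum_range_succ, Finset.sum_range_zero, zero_add, add_zero, Nat.reduceAdd,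
    hf.pd_eq_zero (show 2 < 1 + 2 by omega), hf.pd_eq_zero (show 2 < 2 + 1 by omega),
    hf.pd_eq_zero (show 2 < 2 + 2 by omega), mul_zero]
  ring

/-- The jet with all coordinates of order at least three replaced by zero. -/
noncomputable def truncJet (z : Jet) : Jet := fun k => if k ∈ coordsUpTo 2 then z k else 0

theorem hasOrderLE_comp_truncJet {n : ℕ} {f : Jet → ℝ} (hf : HasOrderLE n f) :
    HasOrderLE 2 (fun z => f (truncJet z)) := by
  obtain ⟨g, hg, hgf⟩ := hf
  refine ⟨fun y => g fun k => if h : (k : JetCoord) ∈ coordsUpTo 2 then y ⟨k, h⟩ else 0, ?_,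
    fun z => ?_⟩
  · refine hg.comp (contDiff_pi.2 fun k => ?_)
    by_cases h : (k : JetCoord) ∈ coordsUpTo 2
    · simpa [h] using contDiff_apply ℝ ℝ _
    · simpa [h] using contDiff_const
  · refine (hgf _).trans (congrArg g (funext fun k => ?_))
    by_cases h : (k : JetCoord) ∈ coordsUpTo 2 <;> simp [truncJet, h]

/-- Setting all coordinates of order at least three to zero. -/
noncomputable def rho : DiffFun →ₐ[ℝ] DiffFun where
  toFun f := ⟨fun z => f.toFun (truncJet z), let ⟨_, hn⟩ := f.2; ⟨2, hasOrderLE_comp_truncJet hn⟩⟩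
  map_one' := rfl
  map_mul' _ _ := rfl
  map_zero' := rfl
  map_add' _ _ := rfl
  commutes' _ := rfl

theorem ev_rho (z : Jet) (f : DiffFun) : ev z (rho f) = ev (truncJet z) f := rfl

theorem rho_co_of_mem {k : JetCoord} (hk : k ∈ coordsUpTo 2) : rho (co k) = co k :=
  ext_ev fun z => by simp [ev_rho, truncJet, hk]

theorem rho_co_of_lt {i j : ℕ} (h : 2 < i + j) : rho (co (u i j)) = 0 :=
  ext_ev fun z => by
    have h' : u i j ∉ coordsUpTo 2 := by
      rw [mem_coordsUpTo_u]
      omega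
    simp [ev_rho, truncJet, h']

theorem Ord.rho {f : DiffFun} (hf : Ord 2 f) : rho f = f :=
  ext_ev fun z => hf.congr_jet fun k hk => by simp [truncJet, hk]

theorem rho_pd {k : JetCoord} (hk : k ∈ coordsUpTo 2) (f : DiffFun) :
    rho (pd k f) = pd k (rho f) := by
  refine ext_ev fun z => ?_
  have h : ∀ s, truncJet (Function.update z k s) = Function.update (truncJet z) k s := by
    intro s
    ext l
    by_cases hl : l = k
    · subst hl
      simp [truncJet, hk]
    · simp [truncJet, hl]
  change deriv (fun s => f.toFun (Function.update (truncJet z) k s)) (truncJet z k)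
    = deriv (fun s => f.toFun (truncJet (Function.update z k s))) (z k)
  simp only [h]
  simp [truncJet, hk]

/-- The total `t`-derivative on jets of second order polynomials. -/
noncomputable def T₂ : Derivation ℝ DiffFun DiffFun :=
  pd t + co (u 1 0) • pd (u 0 0) + co (u 2 0) • pd (u 1 0) + co (u 1 1) • pd (u 0 1)

/-- The total `x`-derivative on jets of second order polynomials. -/
noncomputable def X₂ : Derivation ℝ DiffFun DiffFun :=
  pd x + co (u 0 1) • pd (u 0 0) + co (u 1 1) • pd (u 1 0) + co (u 0 2) • pd (u 0 1)

theorem T₂_apply (f : DiffFun) : T₂ f = pd t f + co (u 1 0) * pd (u 0 0) f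
    + co (u 2 0) * pd (u 1 0) f + co (u 1 1) * pd (u 0 1) f := rfl

theorem X₂_apply (f : DiffFun) : X₂ f = pd x f + co (u 0 1) * pd (u 0 0) f
    + co (u 1 1) * pd (u 1 0) f + co (u 0 2) * pd (u 0 1) f := rfl

/-- Only `u_00`, `u_10`, `u_01` are shifted to coordinates of order at most two; every other
coefficient of the total derivative is set to zero by `rho`. -/
theorem rho_truncD {k : JetCoord} (hk : k ∈ coordsUpTo 2) {a b : ℕ} (hab : a + b = 1) (N : ℕ)
    (f : DiffFun) : rho (truncD k a b (N + 2) f) = pd k (rho f)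
      + co (u a b) * pd (u 0 0) (rho f) + co (u (1 + a) b) * pd (u 1 0) (rho f)
      + co (u a (1 + b)) * pd (u 0 1) (rho f) := by
  have h : ∀ p : ℕ × ℕ, 1 < p.1 + p.2 → rho (co (u (p.1 + a) (p.2 + b))) = 0 := fun p hp =>
    rho_co_of_lt (by omega)
  have h' : ∀ i j, i + j ≤ 1 → rho (co (u (i + a) (j + b))) * rho (pd (u i j) f)
      = co (u (i + a) (j + b)) * pd (u i j) (rho f) := fun i j hij => by
    rw [rho_co_of_mem (mem_coordsUpTo_u.2 (by omega)), rho_pd (mem_coordsUpTo_u.2 (by omega))]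
  rw [truncD_apply, map_add, rho_pd hk, map_sum]
  simp only [map_sum, map_mul]
  rw [← Finset.sum_product', ← Finset.sum_subset
    (s₁ := ({(0, 0), (1, 0), (0, 1)} : Finset (ℕ × ℕ)))]
  · rw [Finset.sum_insert (by simp), Finset.sum_insert (by simp), Finset.sum_singleton,
      h' 0 0 (by omega), h' 1 0 (by omega), h' 0 1 (by omega)]
    simp only [zero_add]
    ring
  · intro p hp
    simp only [Finset.mem_insert, Finset.mem_singleton] at hp
    rcases hp with rfl | rfl | rfl <;> simp
  · rintro ⟨i, j⟩ - hp
    have : 1 < i + j := by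
      by_contra hc
      apply hp
      have : i = 0 ∧ j = 0 ∨ i = 1 ∧ j = 0 ∨ i = 0 ∧ j = 1 := by omega
      rcases this with ⟨rfl, rfl⟩ | ⟨rfl, rfl⟩ | ⟨rfl, rfl⟩ <;> simp
    rw [h (i, j) this, zero_mul]

theorem rho_T (f : DiffFun) : rho (T f) = T₂ (rho f) := by
  obtain ⟨n, hn⟩ := f.exists_order
  rw [D_eq_truncD t 1 0 (f := f) hn (show n < n + 2 by omega),
    rho_truncD (t_mem_coordsUpTo 2) rfl, T₂_apply]

theorem rho_X (f : DiffFun) : rho (X f) = X₂ (rho f) := by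
  obtain ⟨n, hn⟩ := f.exists_order
  rw [D_eq_truncD x 0 1 (f := f) hn (show n < n + 2 by omega),
    rho_truncD (x_mem_coordsUpTo 2) rfl, X₂_apply]

-- The equation and the Euler expression of `φ F`

local notation "∂t" => pd t
local notation "∂x" => pd x
local notation "∂u" => pd (u 0 0)
local notation "∂v" => pd (u 1 0)
local notation "∂w" => pd (u 0 1)
local notation "∂p" => pd (u 2 0)
local notation "∂q" => pd (u 1 1)
local notation "∂r" => pd (u 0 2)
local notation "cu" => co (u 0 0)
local notation "cv" => co (u 1 0)
local notation "cw" => co (u 0 1)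
local notation "cp" => co (u 2 0)
local notation "cq" => co (u 1 1)
local notation "cr" => co (u 0 2)
local notation "c₃₀" => co (u 3 0)
local notation "c₂₁" => co (u 2 1)
local notation "c₁₂" => co (u 1 2)
local notation "c₀₃" => co (u 0 3)

/-- The part of `u_t - u_txx - u u_xxx - 2 u_x u_xx + 3 u² u_x` of order two. -/
noncomputable def eqQ : DiffFun := cv - (cw * cr + cw * cr) + 3 * (cu * cu * cw)

/-- The differential function `u_t - u_txx - u u_xxx - 2 u_x u_xx + 3 u² u_x`. -/
noncomputable def eqDF : DiffFun := eqQ - c₁₂ - cu * c₀₃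

theorem toFun_eqDF : eqDF.toFun = eqF := by
  ext z
  simp only [toFun_apply, eqDF, eqQ, map_add, map_sub, map_mul, ev_co, eqF, map_ofNat]
  ring

theorem pd_mul (k : JetCoord) (f g : DiffFun) : pd k (f * g) = f * pd k g + g * pd k f :=
  (pd k).leibniz f g

theorem map_ofNat_eq_zero (E : Derivation ℝ DiffFun DiffFun) (n : ℕ) [n.AtLeastTwo] :
    E ofNat(n) = 0 := E.map_natCast n

theorem eq_zero_of_ofNat_mul {n : ℕ} [n.AtLeastTwo] {f : DiffFun}
    (h : (ofNat(n) : DiffFun) * f = 0) : f = 0 := by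
  refine ext_ev fun z => ?_
  have h' := congrArg (ev z) h
  rw [map_mul, map_ofNat, map_zero] at h'
  simpa using h'

theorem T_mul (f g : DiffFun) : T (f * g) = f * T g + g * T f := T.leibniz f g

theorem X_mul (f g : DiffFun) : X (f * g) = f * X g + g * X f := X.leibniz f g

theorem ord_eqDF : Ord 3 eqDF := by
  have h : ∀ i j, i + j ≤ 3 → Ord 3 (co (u i j)) := fun i j hij => ord_co (mem_coordsUpTo_u.2 hij)
  have h3 : Ord 3 (3 : DiffFun) := by
    have := ord_algebraMap 3 3
    rwa [map_ofNat] at this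
  unfold eqDF eqQ
  exact ((((h 1 0 (by simp)).sub (((h 0 1 (by simp)).mul (h 0 2 (by simp))).add
    ((h 0 1 (by simp)).mul (h 0 2 (by simp))))).add
    (h3.mul (((h 0 0 (by simp)).mul (h 0 0 (by simp))).mul (h 0 1 (by simp))))).sub
    (h 1 2 (by simp))).sub ((h 0 0 (by simp)).mul (h 0 3 (by simp)))

/-- `φ` has order two and `F` is affine in its third-order coordinates, so the only third-order
partials of `φ F` are `-φ` at `u_txx` and `-uφ` at `u_xxx`; they produce the last two terms. -/
theorem eulerSum_mul_eqDF {φ : DiffFun} (hφ : Ord 2 φ) :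
    eulerSum 4 (φ * eqDF) = ∂u (φ * eqDF) - T (∂v (φ * eqDF)) - X (∂w (φ * eqDF))
      + T (T (∂p (φ * eqDF))) + T (X (∂q (φ * eqDF))) + X (X (∂r (φ * eqDF)))
      + T (X (X φ)) + X (X (X (cu * φ))) := by
  have hL : Ord 3 (φ * eqDF) := (hφ.mono (by omega)).mul ord_eqDF
  have h30 : pd (u 3 0) (φ * eqDF) = 0 := by
    rw [pd_mul, hφ.pd_eq_zero (by omega)]
    simp [eqDF, eqQ, pd_co, map_ofNat_eq_zero]
  have h21 : pd (u 2 1) (φ * eqDF) = 0 := by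
    rw [pd_mul, hφ.pd_eq_zero (by omega)]
    simp [eqDF, eqQ, pd_co, map_ofNat_eq_zero]
  have h12 : pd (u 1 2) (φ * eqDF) = -φ := by
    rw [pd_mul, hφ.pd_eq_zero (by omega)]
    simp [eqDF, eqQ, pd_co, map_ofNat_eq_zero]
  have h03 : pd (u 0 3) (φ * eqDF) = -(cu * φ) := by
    rw [pd_mul, hφ.pd_eq_zero (by omega)]
    simp [eqDF, eqQ, pd_co, map_ofNat_eq_zero]
    ring
  simp only [eulerSum, Finset.sum_range_succ, Finset.sum_range_zero, zero_add, h30, h21, h12, h03,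
    hL.pd_eq_zero (show 3 < 1 + 3 by omega), hL.pd_eq_zero (show 3 < 2 + 2 by omega),
    hL.pd_eq_zero (show 3 < 2 + 3 by omega), hL.pd_eq_zero (show 3 < 3 + 1 by omega),
    hL.pd_eq_zero (show 3 < 3 + 2 by omega), hL.pd_eq_zero (show 3 < 3 + 3 by omega),
    map_zero, add_zero, Module.End.mul_apply, pow_zero, Module.End.one_apply, pow_succ,
    negT_apply, negX_apply, map_neg, neg_neg]
  ring

/-! ### Coefficients of the fourth-order coordinates -/

/-- This and the next four lemmas differentiate `E_u(φ F) = 0` in one fourth-order coordinate each,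
moving the partial derivative inward by the commutator rules until it meets `φ` or `F`. -/
theorem euler_pd40 {φ : DiffFun} (hφ : Ord 2 φ) (hE : eulerSum 4 (φ * eqDF) = 0) :
    eqDF * ∂p (∂p φ) = 0 := by
  have h := congrArg (pd (u 4 0)) (eulerSum_mul_eqDF hφ)
  have h₁ : ∀ i j, 2 < i + j → pd (u i j) φ = 0 := fun i j h => hφ.pd_eq_zero h
  have h₂ : ∀ k i j, 2 < i + j → pd (u i j) (pd k φ) = 0 := fun k i j h => (hφ.pd k).pd_eq_zero h
  rw [hE] at h
  simp [pd_mul, pd_zero_T, pd_zero_X, pd_succ_T, pd_succ_X, pd_co, h₁, h₂, eqDF, eqQ,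
    map_ofNat_eq_zero, -Derivation.leibniz, -mul_eq_zero] at h
  unfold eqDF eqQ
  linear_combination -h

theorem euler_pd31 {φ : DiffFun} (hφ : Ord 2 φ) (hE : eulerSum 4 (φ * eqDF) = 0) :
    eqDF * ∂p (∂q φ) + X (∂p φ) = 0 := by
  have h := congrArg (pd (u 3 1)) (eulerSum_mul_eqDF hφ)
  have h₁ : ∀ i j, 2 < i + j → pd (u i j) φ = 0 := fun i j h => hφ.pd_eq_zero h
  have h₂ : ∀ k i j, 2 < i + j → pd (u i j) (pd k φ) = 0 := fun k i j h => (hφ.pd k).pd_eq_zero h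
  rw [hE] at h
  simp [pd_mul, pd_zero_T, pd_zero_X, pd_succ_T, pd_succ_X, pd_co, h₁, h₂, eqDF, eqQ,
    map_ofNat_eq_zero, -Derivation.leibniz, -mul_eq_zero] at h
  refine eq_zero_of_ofNat_mul (n := 2) ?_
  rw [pd_comm (u 1 1) (u 2 0)] at h
  unfold eqDF eqQ
  linear_combination -h

theorem euler_pd22 {φ : DiffFun} (hφ : Ord 2 φ) (hE : eulerSum 4 (φ * eqDF) = 0) :
    eqDF * (∂q (∂q φ) + 2 * ∂p (∂r φ)) - T (∂p φ) + X (∂q φ) + 3 * (cu * X (∂p φ)) - cw * ∂p φ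
      + 2 * ∂v φ = 0 := by
  have h := congrArg (pd (u 2 2)) (eulerSum_mul_eqDF hφ)
  have h₁ : ∀ i j, 2 < i + j → pd (u i j) φ = 0 := fun i j h => hφ.pd_eq_zero h
  have h₂ : ∀ k i j, 2 < i + j → pd (u i j) (pd k φ) = 0 := fun k i j h => (hφ.pd k).pd_eq_zero h
  rw [hE] at h
  simp [pd_mul, pd_zero_T, pd_zero_X, pd_succ_T, pd_succ_X, pd_co, h₁, h₂, eqDF, eqQ,
    map_ofNat_eq_zero, -Derivation.leibniz, -mul_eq_zero] at h
  simp [T_mul, X_mul, map_ofNat_eq_zero, -Derivation.leibniz] at h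
  rw [pd_comm (u 0 2) (u 2 0)] at h
  unfold eqDF eqQ
  linear_combination -h

theorem euler_pd13 {φ : DiffFun} (hφ : Ord 2 φ) (hE : eulerSum 4 (φ * eqDF) = 0) :
    eqDF * ∂q (∂r φ) + cu * X (∂q φ) - cu * T (∂p φ) - cw * ∂q φ - cv * ∂p φ + ∂w φ
      + cu * ∂v φ = 0 := by
  have h := congrArg (pd (u 1 3)) (eulerSum_mul_eqDF hφ)
  have h₁ : ∀ i j, 2 < i + j → pd (u i j) φ = 0 := fun i j h => hφ.pd_eq_zero h
  have h₂ : ∀ k i j, 2 < i + j → pd (u i j) (pd k φ) = 0 := fun k i j h => (hφ.pd k).pd_eq_zero h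
  rw [hE] at h
  simp [pd_mul, pd_zero_T, pd_zero_X, pd_succ_T, pd_succ_X, pd_co, h₁, h₂, eqDF, eqQ,
    map_ofNat_eq_zero, -Derivation.leibniz, -mul_eq_zero] at h
  simp [T_mul, X_mul, map_ofNat_eq_zero, -Derivation.leibniz] at h
  refine eq_zero_of_ofNat_mul (n := 2) ?_
  rw [pd_comm (u 0 2) (u 1 1)] at h
  unfold eqDF eqQ
  linear_combination -h

theorem euler_pd04 {φ : DiffFun} (hφ : Ord 2 φ) (hE : eulerSum 4 (φ * eqDF) = 0) :
    eqDF * ∂r (∂r φ) + T (∂r φ) + cu * X (∂r φ) - cu * T (∂q φ) - 3 * (cw * ∂r φ) - cv * ∂q φ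
      + 2 * (cu * ∂w φ) = 0 := by
  have h := congrArg (pd (u 0 4)) (eulerSum_mul_eqDF hφ)
  have h₁ : ∀ i j, 2 < i + j → pd (u i j) φ = 0 := fun i j h => hφ.pd_eq_zero h
  have h₂ : ∀ k i j, 2 < i + j → pd (u i j) (pd k φ) = 0 := fun k i j h => (hφ.pd k).pd_eq_zero h
  rw [hE] at h
  simp [pd_mul, pd_zero_T, pd_zero_X, pd_succ_T, pd_succ_X, pd_co, h₁, h₂, eqDF, eqQ,
    map_ofNat_eq_zero, -Derivation.leibniz, -mul_eq_zero] at h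
  simp [T_mul, X_mul, map_ofNat_eq_zero, -Derivation.leibniz] at h
  unfold eqDF eqQ
  linear_combination -h

/-- A terminating normal form for `simp`: innermost to outermost the order is `p, r, w, u, q, v, x,
t`, so derivatives that get eliminated (`∂p`, `∂r`, `∂w`, `∂u`) stand next to the function. -/
theorem pd_comm_normal (f : DiffFun) :
    ∂p (∂r f) = ∂r (∂p f) ∧ ∂p (∂w f) = ∂w (∂p f) ∧ ∂p (∂u f) = ∂u (∂p f) ∧
    ∂p (∂q f) = ∂q (∂p f) ∧ ∂p (∂v f) = ∂v (∂p f) ∧ ∂p (∂x f) = ∂x (∂p f) ∧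
    ∂p (∂t f) = ∂t (∂p f) ∧ ∂r (∂w f) = ∂w (∂r f) ∧ ∂r (∂u f) = ∂u (∂r f) ∧
    ∂r (∂q f) = ∂q (∂r f) ∧ ∂r (∂v f) = ∂v (∂r f) ∧ ∂r (∂x f) = ∂x (∂r f) ∧
    ∂r (∂t f) = ∂t (∂r f) ∧ ∂w (∂u f) = ∂u (∂w f) ∧ ∂w (∂q f) = ∂q (∂w f) ∧
    ∂w (∂v f) = ∂v (∂w f) ∧ ∂w (∂x f) = ∂x (∂w f) ∧ ∂w (∂t f) = ∂t (∂w f) ∧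
    ∂u (∂q f) = ∂q (∂u f) ∧ ∂u (∂v f) = ∂v (∂u f) ∧ ∂u (∂x f) = ∂x (∂u f) ∧
    ∂u (∂t f) = ∂t (∂u f) ∧ ∂q (∂v f) = ∂v (∂q f) ∧ ∂q (∂x f) = ∂x (∂q f) ∧
    ∂q (∂t f) = ∂t (∂q f) ∧ ∂v (∂x f) = ∂x (∂v f) ∧ ∂v (∂t f) = ∂t (∂v f) ∧
    ∂x (∂t f) = ∂t (∂x f) := by
  refine ⟨?_, ?_, ?_, ?_, ?_, ?_, ?_, ?_, ?_, ?_, ?_, ?_, ?_, ?_, ?_, ?_, ?_, ?_, ?_, ?_, ?_, ?_, ?_,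
    ?_, ?_, ?_, ?_, ?_⟩ <;> exact pd_comm _ _ f

theorem pd_eqQ : ∂t eqQ = 0 ∧ ∂x eqQ = 0 ∧ ∂u eqQ = 6 * (cu * cw) ∧ ∂v eqQ = 1 ∧
    ∂w eqQ = 3 * (cu * cu) - (cr + cr) ∧ ∂p eqQ = 0 ∧ ∂q eqQ = 0 ∧ ∂r eqQ = -(cw + cw) ∧
    pd (u 1 2) eqQ = 0 ∧ pd (u 0 3) eqQ = 0 := by
  refine ⟨?_, ?_, ?_, ?_, ?_, ?_, ?_, ?_, ?_, ?_⟩ <;>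
    simp [eqQ, pd_mul, pd_co, map_ofNat_eq_zero, -Derivation.leibniz]
  · ring
  · ring

/-- The consequences of the equation `E_u (φ F) = 0` obtained from the coefficients of the fourth
order coordinates. -/
theorem second_order_equations {φ : DiffFun} (hφ : Ord 2 φ) (hE : eulerSum 4 (φ * eqDF) = 0) :
    ∂p (∂p φ) = 0 ∧ ∂r (∂p φ) = cu * ∂q (∂p φ) ∧
    ∂q (∂r φ) = cu * ∂q (∂q φ) - cu * ∂r (∂p φ) ∧
    eqQ * ∂q (∂p φ) + X₂ (∂p φ) = 0 ∧
    eqQ * (∂q (∂q φ) + 2 * ∂r (∂p φ)) - T₂ (∂p φ) + X₂ (∂q φ) + 3 * (cu * X₂ (∂p φ))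
      - cw * ∂p φ + 2 * ∂v φ = 0 ∧
    eqQ * ∂q (∂r φ) + cu * X₂ (∂q φ) - cu * T₂ (∂p φ) - cw * ∂q φ - cv * ∂p φ + ∂w φ
      + cu * ∂v φ = 0 ∧
    eqQ * ∂r (∂r φ) + T₂ (∂r φ) + cu * X₂ (∂r φ) - cu * T₂ (∂q φ) - 3 * (cw * ∂r φ)
      - cv * ∂q φ + 2 * (cu * ∂w φ) = 0 := by
  have e40 := euler_pd40 hφ hE
  have e31 := euler_pd31 hφ hE
  have e22 := euler_pd22 hφ hE
  have e13 := euler_pd13 hφ hE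
  have e04 := euler_pd04 hφ hE
  rw [X_of_ord_two (hφ.pd _)] at e31
  rw [X_of_ord_two (hφ.pd _), X_of_ord_two (hφ.pd _), T_of_ord_two (hφ.pd _)] at e22
  rw [X_of_ord_two (hφ.pd _), T_of_ord_two (hφ.pd _)] at e13
  rw [X_of_ord_two (hφ.pd _), T_of_ord_two (hφ.pd _), T_of_ord_two (hφ.pd _)] at e04
  have h₂ : ∀ k l i j, 2 < i + j → pd (u i j) (pd l (pd k φ)) = 0 :=
    fun k l i j h => ((hφ.pd k).pd l).pd_eq_zero h
  have h₁ : ∀ k i j, 2 < i + j → pd (u i j) (pd k φ) = 0 := fun k i j h => (hφ.pd k).pd_eq_zero h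
  -- These equations are affine in the third-order coordinates, and `F` contains `-u_txx - u u_xxx`.
  -- These coefficients give the three relations among second derivatives; with them all third-order
  -- terms cancel.
  have hpp := congrArg (pd (u 1 2)) e40
  have hpr := congrArg (pd (u 0 3)) e31
  have hqr := congrArg (pd (u 0 3)) e22
  simp [pd_mul, pd_co, eqDF, pd_eqQ, h₁, h₂, map_ofNat_eq_zero, pd_comm_normal,
    -Derivation.leibniz, -mul_eq_zero] at hpp hpr hqr
  have hpp' : ∂p (∂p φ) = 0 := by simpa using hpp
  have hpr' : ∂r (∂p φ) = cu * ∂q (∂p φ) := by linear_combination hpr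
  have hqr' : ∂q (∂r φ) = cu * ∂q (∂q φ) - cu * ∂r (∂p φ) := by linear_combination hqr
  simp only [eqDF, pd_comm_normal, hpp'] at e31 e22 e13 e04
  simp only [T₂_apply, X₂_apply, pd_comm_normal]
  refine ⟨hpp', hpr', hqr', ?_, ?_, ?_, ?_⟩
  · linear_combination e31 - c₀₃ * hpr'
  · linear_combination e22 + 3 * c₁₂ * hpr' - c₀₃ * hqr'
  · linear_combination e13 + c₁₂ * hqr'
  · linear_combination e04 - c₃₀ * hpr' - c₂₁ * hqr'

/-! ### Integration of the second-order equations -/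

/-- The vector fields `∂r - u∂q` and `Y = X₂ + Q∂q` annihilate `a`, hence so do their brackets. The
first bracket is `W = ∂w - u∂v - w∂q`; then `[W, Y] = U = ∂u - (r - 3u² + u)∂q`, `[W, U] = ∂v` and
`[∂v, Y] = ∂q`. Together these kill every derivative listed. -/
theorem pd_eq_zero_of_X₂_eq {a : DiffFun} (hr : ∂r a = cu * ∂q a)
    (h : eqQ * ∂q a + X₂ a = 0) :
    ∂q a = 0 ∧ ∂v a = 0 ∧ ∂u a = 0 ∧ ∂w a = 0 ∧ ∂x a = 0 := by
  rw [X₂_apply] at h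
  have h₁ := congrArg ∂r h
  have h₂ := congrArg ∂q h
  simp [pd_mul, pd_co, pd_eqQ, map_ofNat_eq_zero, pd_comm_normal, hr,
    -Derivation.leibniz, -mul_eq_zero] at h₁ h₂
  have hw : ∂w a = cu * ∂v a + cw * ∂q a := by linear_combination h₁ - cu * h₂
  have h₃ := congrArg ∂w h
  have h₄ := congrArg ∂v h
  simp [pd_mul, pd_co, pd_eqQ, map_ofNat_eq_zero, pd_comm_normal, hr, hw,
    -Derivation.leibniz, -mul_eq_zero] at h₂ h₃ h₄
  have hu : ∂u a = (cr - 3 * (cu * cu) + cu) * ∂q a := by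
    linear_combination h₃ - cu * h₄ - cw * h₂
  have h₅ := congrArg ∂w hu
  have h₆ := congrArg ∂v hu
  have h₇ := congrArg ∂q hu
  simp [pd_mul, pd_co, pd_eqQ, map_ofNat_eq_zero, pd_comm_normal, hr, hw,
    -Derivation.leibniz, -mul_eq_zero] at h₅ h₆ h₇
  have hv : ∂v a = 0 := by
    linear_combination h₅ - cu * h₆ - cw * h₇
  have hvq : ∂v (∂q a) = 0 := by rw [pd_comm, hv, map_zero]
  simp [hr, hw, hu, hv, hvq, pd_mul, pd_co, map_ofNat_eq_zero, -Derivation.leibniz, -mul_eq_zero] at h₄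
  simp only [h₄, hv, mul_zero, add_zero] at hw hu
  simp only [h₄, hv, hw, hu, mul_zero, add_zero, zero_add] at h
  exact ⟨h₄, hv, hu, hw, h⟩

/-- The function does not depend on the coordinates of order at most two other than `t`, `x`. -/
structure OnlyTX (a : DiffFun) : Prop where
  p : ∂p a = 0
  q : ∂q a = 0
  r : ∂r a = 0
  v : ∂v a = 0
  w : ∂w a = 0
  u : ∂u a = 0

/-- The function does not depend on the coordinates of order at most two other than `t`. -/
structure OnlyT (a : DiffFun) : Prop extends OnlyTX a where
  x : ∂x a = 0

theorem OnlyTX.pd {a : DiffFun} (ha : OnlyTX a) (k : JetCoord) : OnlyTX (pd k a) where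
  p := by rw [pd_comm, ha.p, map_zero]
  q := by rw [pd_comm, ha.q, map_zero]
  r := by rw [pd_comm, ha.r, map_zero]
  v := by rw [pd_comm, ha.v, map_zero]
  w := by rw [pd_comm, ha.w, map_zero]
  u := by rw [pd_comm, ha.u, map_zero]

theorem OnlyTX.T₂_eq {a : DiffFun} (ha : OnlyTX a) : T₂ a = ∂t a := by
  simp [T₂_apply, ha.u, ha.v, ha.w]

theorem OnlyTX.X₂_eq {a : DiffFun} (ha : OnlyTX a) : X₂ a = ∂x a := by
  simp [X₂_apply, ha.u, ha.v, ha.w]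

/-- The same bracket argument for `c = ∂q φ`, now with inhomogeneous equations: `a`, `f`, `h` stand
for `∂p φ`, `∂v φ`, `∂w φ`, and `hfq`, `hhq`, `hhv` are symmetries of mixed derivatives of `φ`. -/
theorem pd_q_of_equations {a c f h : DiffFun} (ha : OnlyT a) (hp : ∂p c = 0)
    (hr : ∂r c = cu * ∂q c) (hfq : ∂q f = ∂v c) (hhq : ∂q h = ∂w c) (hhv : ∂v h = ∂w f)
    (e₁ : eqQ * ∂q c - ∂t a + X₂ c - cw * a + 2 * f = 0)
    (e₂ : h = cu * f + cw * c + cv * a - cu * cw * a) :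
    OnlyT (∂q c) ∧ ∂v c = 0 ∧ ∂w c = cw * ∂q c ∧
      ∂u c = (cr - 3 * (cu * cu) + cu) * ∂q c - a := by
  rw [X₂_apply] at e₁
  have hw := congrArg ∂q e₂
  have hfw := congrArg ∂v e₂
  simp [pd_mul, pd_co, pd_eqQ, map_ofNat_eq_zero, pd_comm_normal, hp, hr, hfq, hhq, hhv, ha.p,
    ha.q, ha.r, ha.v, ha.w, ha.u, ha.x, -Derivation.leibniz, -mul_eq_zero] at hw hfw
  have h₁ := congrArg ∂w e₁
  have h₂ := congrArg ∂v e₁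
  have h₃ := congrArg ∂q e₁
  simp [pd_mul, pd_co, pd_eqQ, map_ofNat_eq_zero, pd_comm_normal, hp, hr, hfq, hw, hfw, ha.p,
    ha.q, ha.r, ha.v, ha.w, ha.u, ha.x, -Derivation.leibniz, -mul_eq_zero] at h₁ h₂ h₃
  have hu : ∂u c = (cr - 3 * (cu * cu) + cu) * ∂q c - a := by
    linear_combination h₁ - cu * h₂ - cw * h₃
  have h₅ := congrArg ∂w hu
  have h₆ := congrArg ∂v hu
  have h₇ := congrArg ∂q hu
  simp [pd_mul, pd_co, pd_eqQ, map_ofNat_eq_zero, pd_comm_normal, hp, hr, hw, ha.p,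
    ha.q, ha.r, ha.v, ha.w, ha.u, ha.x, -Derivation.leibniz, -mul_eq_zero] at h₅ h₆ h₇
  have hv : ∂v c = 0 := by
    linear_combination h₅ - cu * h₆ - cw * h₇
  have hvq : ∂v (∂q c) = 0 := by rw [pd_comm, hv, map_zero]
  have hvqq : ∂v (∂q (∂q c)) = 0 := by rw [pd_comm, hvq, map_zero]
  -- Once `∂v c = 0`, the only `v` left in `h₃` is the one in `Q`, so its `v`-derivative isolates
  -- `∂q (∂q c)`.
  have h₈ := congrArg ∂v h₃
  simp [pd_mul, pd_co, pd_eqQ, map_ofNat_eq_zero, pd_comm_normal, hp, hr, hfq, hw, hfw, hv, hu,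
    hvq, hvqq, ha.p, ha.q, ha.r, ha.v, ha.w, ha.u, ha.x, -Derivation.leibniz, -mul_eq_zero] at h₈
  simp only [hv, mul_zero, zero_add] at hw
  have hp' : ∂p (∂q c) = 0 := by rw [pd_comm, hp, map_zero]
  have hr' : ∂r (∂q c) = 0 := by
    rw [pd_comm, hr]
    simp [pd_mul, pd_co, h₈]
  have hw' : ∂w (∂q c) = 0 := by
    rw [pd_comm, hw]
    simp [pd_mul, pd_co, h₈]
  have hu' : ∂u (∂q c) = 0 := by
    rw [pd_comm, hu]
    simp [pd_mul, pd_co, h₈, map_ofNat_eq_zero, ha.q]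
  refine ⟨⟨⟨hp', h₈, hr', hvq, hw', hu'⟩, ?_⟩, hv, hw, hu⟩
  simpa [hv, hvq, h₈, ← pd_comm (u 0 0), hu'] using h₃

/-! ### The Euler expression on second-order polynomial jets -/

theorem rho_eqDF : rho eqDF = eqQ := by
  have h : ∀ i j, i + j ≤ 2 → rho (co (u i j)) = co (u i j) := fun i j hij =>
    rho_co_of_mem (mem_coordsUpTo_u.2 hij)
  have h' : ∀ i j, 2 < i + j → rho (co (u i j)) = 0 := fun i j hij => rho_co_of_lt hij
  simp [eqDF, eqQ, h, h', map_ofNat]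

theorem T₂_mul (f g : DiffFun) : T₂ (f * g) = f * T₂ g + g * T₂ f := T₂.leibniz f g

theorem X₂_mul (f g : DiffFun) : X₂ (f * g) = f * X₂ g + g * X₂ f := X₂.leibniz f g

theorem T₂_co : T₂ cu = cv ∧ T₂ cv = cp ∧ T₂ cw = cq ∧ T₂ cp = 0 ∧ T₂ cq = 0 ∧ T₂ cr = 0 := by
  simp [T₂_apply, pd_co]

theorem X₂_co : X₂ cu = cw ∧ X₂ cv = cq ∧ X₂ cw = cr ∧ X₂ cp = 0 ∧ X₂ cq = 0 ∧ X₂ cr = 0 := by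
  simp [X₂_apply, pd_co]

/-- The restriction of `E_u (φ F)` to the jets of second order polynomials. -/
noncomputable def eulerTwo (φ : DiffFun) : DiffFun :=
  ∂u (φ * eqQ) - T₂ (∂v (φ * eqQ)) - X₂ (∂w (φ * eqQ))
    + T₂ (T₂ (∂p (φ * eqQ))) + T₂ (X₂ (∂q (φ * eqQ))) + X₂ (X₂ (∂r (φ * eqQ)))
    + T₂ (X₂ (X₂ φ)) + X₂ (X₂ (X₂ (cu * φ)))

theorem eulerTwo_eq_zero {φ : DiffFun} (hφ : Ord 2 φ) (hE : eulerSum 4 (φ * eqDF) = 0) :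
    eulerTwo φ = 0 := by
  have h := congrArg rho (eulerSum_mul_eqDF hφ)
  have hm : ∀ i j, i + j ≤ 2 → ∀ f, rho (pd (u i j) f) = pd (u i j) (rho f) := fun i j hij f =>
    rho_pd (mem_coordsUpTo_u.2 hij) f
  rw [hE, map_zero] at h
  simp only [map_add, map_sub, rho_T, rho_X, hm 0 0 (by omega), hm 1 0 (by omega),
    hm 0 1 (by omega), hm 2 0 (by omega), hm 1 1 (by omega), hm 0 2 (by omega), map_mul, hφ.rho,
    rho_eqDF, rho_co_of_mem (mem_coordsUpTo_u.2 (show 0 + 0 ≤ 2 by omega))] at h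
  exact h.symm

theorem pd_p_T₂ (f : DiffFun) : ∂p (T₂ f) = T₂ (∂p f) + ∂v f := by
  simp only [T₂_apply, map_add, pd_mul, pd_co, pd_comm (u 2 0)]
  simp
  ring

theorem pd_p_X₂ (f : DiffFun) : ∂p (X₂ f) = X₂ (∂p f) := by
  simp only [X₂_apply, map_add, pd_mul, pd_co, pd_comm (u 2 0)]
  simp

theorem pd_v_T₂ (f : DiffFun) : ∂v (T₂ f) = T₂ (∂v f) + ∂u f := by
  simp only [T₂_apply, map_add, pd_mul, pd_co, pd_comm (u 1 0)]
  simp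
  ring

theorem pd_v_X₂ (f : DiffFun) : ∂v (X₂ f) = X₂ (∂v f) := by
  simp only [X₂_apply, map_add, pd_mul, pd_co, pd_comm (u 1 0)]
  simp

/-- On the right `φ` enters only through `∂p φ`, `∂q φ` and `∂v φ`, which the second-order equations
control. -/
theorem pd_p_eulerTwo (φ : DiffFun) :
    ∂p (eulerTwo φ) = 2 * ∂u (eqQ * ∂p φ) + T₂ (∂v (eqQ * ∂p φ)) - X₂ (∂w (eqQ * ∂p φ))
      + T₂ (T₂ (∂p (eqQ * ∂p φ))) + T₂ (X₂ (∂q (eqQ * ∂p φ))) + X₂ (X₂ (∂r (eqQ * ∂p φ)))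
      - 2 * ∂v φ - eqQ * ∂v (∂v φ) + X₂ (∂q φ + eqQ * ∂v (∂q φ)) + T₂ (X₂ (X₂ (∂p φ)))
      + X₂ (X₂ (∂v φ)) + X₂ (X₂ (X₂ (cu * ∂p φ))) := by
  have hp : ∂p (φ * eqQ) = eqQ * ∂p φ := by
    rw [pd_mul]
    simp [pd_eqQ]
  have hvq : ∂v (∂q (φ * eqQ)) = ∂q φ + eqQ * ∂v (∂q φ) := by
    simp [pd_mul, pd_eqQ, -Derivation.leibniz]
    ring
  have hvv : ∂v (∂v (φ * eqQ)) = 2 * ∂v φ + eqQ * ∂v (∂v φ) := by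
    simp [pd_mul, pd_eqQ, -Derivation.leibniz]
    ring
  have hcu : ∂p (cu * φ) = cu * ∂p φ := by
    rw [pd_mul]
    simp [pd_co]
  simp only [eulerTwo, map_add, map_sub, pd_p_T₂, pd_p_X₂, pd_v_X₂, pd_v_T₂,
    pd_comm (u 2 0) (u _ _), hp, hvq, hvv, hcu]
  ring

/-- After elimination of `∂v φ` the `p`-derivative of `eulerTwo φ` is an explicit polynomial in `u,
v, w, r` with coefficients depending on `t` and `x`; its `v`- and `uw`-coefficients are multiples of
`∂q (∂q φ)` and `∂p φ`. -/
theorem eq_zero_of_pd_p_eulerTwo {φ : DiffFun} (ha : OnlyT (∂p φ)) (hm : OnlyT (∂q (∂q φ)))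
    (hv : ∂v (∂q φ) = 0) (hw : ∂w (∂q φ) = cw * ∂q (∂q φ))
    (hu : ∂u (∂q φ) = (cr - 3 * (cu * cu) + cu) * ∂q (∂q φ) - ∂p φ)
    (e₁ : eqQ * ∂q (∂q φ) - ∂t (∂p φ) + X₂ (∂q φ) - cw * ∂p φ + 2 * ∂v φ = 0)
    (hr : ∂r (∂q φ) = cu * ∂q (∂q φ)) (hE : eulerTwo φ = 0) :
    ∂p φ = 0 ∧ ∂q (∂q φ) = 0 := by
  have h := congrArg ∂p hE
  rw [pd_p_eulerTwo, map_zero, hv, mul_zero, add_zero] at h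
  have he : OnlyTX (∂x (∂q φ)) :=
    { p := by rw [pd_comm, pd_comm (u 2 0), ha.q, map_zero]
      q := by rw [pd_comm, hm.x]
      r := by
        rw [pd_comm, hr]
        simp [pd_mul, pd_co, hm.x]
      v := by rw [pd_comm, hv, map_zero]
      w := by
        rw [pd_comm, hw]
        simp [pd_mul, pd_co, hm.x]
      u := by
        rw [pd_comm, hu]
        simp [pd_mul, pd_co, hm.x, ha.x, map_ofNat_eq_zero] }
  have hX : X₂ (∂q φ) = ∂x (∂q φ) + cw * ((cr - 3 * (cu * cu) + cu) * ∂q (∂q φ) - ∂p φ)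
      + cr * (cw * ∂q (∂q φ)) := by
    rw [X₂_apply, hv, hw, hu]
    ring
  generalize ∂p φ = a at *
  generalize ∂q (∂q φ) = m at *
  generalize ∂x (∂q φ) = e at *
  generalize ∂q φ = c at *
  generalize ∂v φ = f at *
  have hf : 2 * f = ∂t a + 2 * (cw * a) - e - cu * cw * m - cv * m := by
    rw [hX] at e₁
    unfold eqQ at e₁
    linear_combination e₁
  have hfv := congrArg ∂v hf
  have hfx := congrArg (fun g => X₂ (X₂ g)) hf
  simp [pd_mul, pd_co, map_ofNat_eq_zero, he.v, ha.v, hm.v, (ha.pd t).v, X₂_mul, X₂_co,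
    ha.X₂_eq, hm.X₂_eq, he.X₂_eq, ha.x, hm.x, (he.pd x).X₂_eq, (ha.pd t).X₂_eq, pd_comm x t,
    -Derivation.leibniz, -mul_eq_zero] at hfv hfx
  simp [pd_mul, pd_co, pd_eqQ, map_ofNat_eq_zero, he.v, ha.p, ha.q, ha.r, ha.v, ha.w, ha.u,
    hm.v, (ha.pd t).v, X₂_mul, X₂_co, T₂_co, T₂_mul, hX,
    ha.X₂_eq, hm.X₂_eq, he.X₂_eq, ha.x, hm.x, (he.pd x).X₂_eq, (ha.pd t).X₂_eq, pd_comm x t,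
    ha.T₂_eq,
    -Derivation.leibniz, -mul_eq_zero] at h
  -- Twice the equation, so that `f` enters only as `2f`, and its derivatives can be replaced using
  -- `hf`, `hfv`, `hfx`.
  have h' : 12 * (a * (cu * cw)) - 6 * (cw * a) + 4 * e - ∂x (∂x e) + 2 * (cu * cw * m + cv * m)
      + eqQ * m + 2 * (cw * ((cr - 3 * (cu * cu) + cu) * m) + cr * (cw * m))
      - m * (cr * cw + (cw * cr + cw * cr)) = 0 := by
    linear_combination 2 * h - hfx + 2 * hf + eqQ * hfv
  have hm₀ : m = 0 := by
    have h₁ := congrArg ∂v h'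
    simp [pd_mul, pd_co, pd_eqQ, map_ofNat_eq_zero, he.v, ((he.pd x).pd x).v, ha.v, hm.v,
      -Derivation.leibniz, -mul_eq_zero] at h₁
    refine eq_zero_of_ofNat_mul (n := 3) ?_
    linear_combination h₁
  subst hm₀
  have h₁ := congrArg ∂u (congrArg ∂w h')
  simp [pd_mul, pd_co, map_ofNat_eq_zero, he.w, ((he.pd x).pd x).w, ha.w, ha.u,
    -Derivation.leibniz, -mul_eq_zero] at h₁
  exact ⟨eq_zero_of_ofNat_mul h₁, rfl⟩

/-- With `c = ∂q φ` and `d = ∂r φ`, the `v`-coefficient of the equation is `d_u + d_r = c`, and the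
`w`-coefficient is `(3u² - 2r)d_r + u d_u - 3d + 2uc = 0`. Applying `∂u + ∂r` to the latter gives
`3(2u - 1)d_r = 0`, and once more `d_r = 0`; then `3d = 3uc`. -/
theorem eq_mul_of_pd_r_equation {c d f h : DiffFun} (hc : OnlyTX c) (hdv : ∂v d = 0)
    (hdw : ∂w d = 0) (hf : 2 * f = -∂x c) (hh : h = cu * f + cw * c)
    (e : eqQ * ∂r d + T₂ d + cu * X₂ d - cu * T₂ c - 3 * (cw * d) - cv * c + 2 * (cu * h) = 0) :
    d = cu * c := by
  have e' : eqQ * ∂r d + (∂t d + cv * ∂u d) + cu * (∂x d + cw * ∂u d) - cu * ∂t c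
      - 3 * (cw * d) - cv * c + cu * (-(cu * ∂x c) + 2 * (cw * c)) = 0 := by
    rw [T₂_apply, X₂_apply, hc.T₂_eq, hdv, hdw, hh] at e
    linear_combination e - cu * cu * hf
  have hvr : ∂v (∂r d) = 0 := by rw [pd_comm, hdv, map_zero]
  have hvu : ∂v (∂u d) = 0 := by rw [pd_comm, hdv, map_zero]
  have hwr : ∂w (∂r d) = 0 := by rw [pd_comm, hdw, map_zero]
  have hwu : ∂w (∂u d) = 0 := by rw [pd_comm, hdw, map_zero]
  have hvt : ∂v (∂t d) = 0 := by rw [pd_comm, hdv, map_zero]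
  have hvx : ∂v (∂x d) = 0 := by rw [pd_comm, hdv, map_zero]
  have hwt : ∂w (∂t d) = 0 := by rw [pd_comm, hdw, map_zero]
  have hwx : ∂w (∂x d) = 0 := by rw [pd_comm, hdw, map_zero]
  have h₁ := congrArg ∂v e'
  have h₂ := congrArg ∂w e'
  simp [pd_mul, pd_co, pd_eqQ, map_ofNat_eq_zero, hdv, hdw, hvr, hvu, hwr, hwu, hvt, hvx, hwt, hwx,
    hc.v, hc.w, (hc.pd t).v, (hc.pd x).v, (hc.pd t).w, (hc.pd x).w,
    -Derivation.leibniz, -mul_eq_zero] at h₁ h₂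
  have hu : ∂u d = c - ∂r d := by linear_combination h₁
  have hur : ∂u (∂r d) = -∂r (∂r d) := by
    rw [pd_comm, hu, map_sub, hc.r, zero_sub]
  have h₃ := congrArg ∂r h₂
  have h₄ := congrArg ∂u h₂
  simp [pd_mul, pd_co, map_ofNat_eq_zero, hu, hur, pd_comm (u 0 2) (u 0 0), hc.r, hc.u,
    -Derivation.leibniz, -mul_eq_zero] at h₃ h₄
  have h₅ : 2 * (cu * ∂r d) - ∂r d = 0 := by
    refine eq_zero_of_ofNat_mul (n := 3) ?_
    linear_combination h₃ + h₄
  have h₆ := congrArg ∂r h₅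
  have h₇ := congrArg ∂u h₅
  simp [pd_mul, pd_co, map_ofNat_eq_zero, hur, -Derivation.leibniz, -mul_eq_zero] at h₆ h₇
  have hr : ∂r d = 0 := by
    refine eq_zero_of_ofNat_mul (n := 2) ?_
    linear_combination h₆ + h₇
  rw [hu, hr] at h₂
  refine (sub_eq_zero.1 (eq_zero_of_ofNat_mul (n := 3) ?_)).symm
  linear_combination h₂

/-! ### The remaining unknowns `c(t,x)` and `g(t,x,u)` -/

/-- The function does not depend on the coordinates of order at most two other than `t`, `x`, `u`. -/
structure OnlyTXU (a : DiffFun) : Prop where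
  p : ∂p a = 0
  q : ∂q a = 0
  r : ∂r a = 0
  v : ∂v a = 0
  w : ∂w a = 0

theorem OnlyTXU.pd {a : DiffFun} (ha : OnlyTXU a) (k : JetCoord) : OnlyTXU (pd k a) where
  p := by rw [pd_comm, ha.p, map_zero]
  q := by rw [pd_comm, ha.q, map_zero]
  r := by rw [pd_comm, ha.r, map_zero]
  v := by rw [pd_comm, ha.v, map_zero]
  w := by rw [pd_comm, ha.w, map_zero]

theorem OnlyTXU.T₂_eq {a : DiffFun} (ha : OnlyTXU a) : T₂ a = ∂t a + cv * ∂u a := by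
  simp [T₂_apply, ha.v, ha.w]

theorem OnlyTXU.X₂_eq {a : DiffFun} (ha : OnlyTXU a) : X₂ a = ∂x a + cw * ∂u a := by
  simp [X₂_apply, ha.v, ha.w]

theorem eulerTwo_add (f g : DiffFun) : eulerTwo (f + g) = eulerTwo f + eulerTwo g := by
  simp only [eulerTwo, add_mul, mul_add, map_add]
  ring

theorem eulerTwo_sub (f g : DiffFun) : eulerTwo (f - g) = eulerTwo f - eulerTwo g := by
  simp only [eulerTwo, sub_mul, mul_sub, map_sub]
  ring

/-- The value of `eulerTwo` on the functions left after the analysis of the second order terms. -/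
theorem eulerTwo_ansatz {c g : DiffFun} (hc : OnlyTX c) (hg : OnlyTXU g) :
    eulerTwo (c * (2 * (cq + cu * cr) + cw * cw) - ∂x c * (cv + cu * cw) + g) =
      (2 * cq * cw + 3 * cr * cu * cw + cr * cv + cw * cw * cw) * ∂u (∂u g)
      + (cu * cw * cw * cw + cv * cw * cw) * ∂u (∂u (∂u g))
      + (cr - 3 * cu * cu) * ∂x g
      + (2 * cq + 3 * cr * cu + 2 * cw * cw) * ∂x (∂u g)
      + (3 * cu * cw * cw + 2 * cv * cw) * ∂x (∂u (∂u g))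
      + (cw) * ∂x (∂x g)
      + (3 * cu * cw + cv) * ∂x (∂x (∂u g))
      + (cu) * ∂x (∂x (∂x g))
      + (-1) * ∂t g
      + (cr) * ∂t (∂u g)
      + (cw * cw) * ∂t (∂u (∂u g))
      + (2 * cw) * ∂t (∂x (∂u g))
      + (1) * ∂t (∂x (∂x g))
      + (24 * cq * cu * cw + 12 * cr * cu * cv + 36 * cr * cu * cu * cw + 24 * cu * cw * cw * cw +
        12 * cv * cw * cw) * c
      + (4 * cp + 6 * cq * cu + 6 * cq * cu * cu + 12 * cr * cu * cu * cu + cr * cw * cw + 18 * cu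
        * cv * cw + 36 * cu * cu * cw * cw + 3 * cv * cw) * ∂x c
      + (-2 * cq * cw - 4 * cr * cu * cw - cr * cv + 3 * cu * cv + 3 * cu * cu * cv + 12 * cu * cu
        * cu * cw - cw * cw * cw) * ∂x (∂x c)
      + (-cp - 2 * cq * cu - cr * cu * cu - 3 * cu * cw * cw - 2 * cv * cw) * ∂x (∂x (∂x c))
      + (-cu * cv - cu * cu * cw) * ∂x (∂x (∂x (∂x c)))
      + (-2 * cr * cu + 6 * cr * cu * cu + 12 * cu * cw * cw - cw * cw) * ∂t c
      + (-cr * cw + cu * cw + 9 * cu * cu * cw + 4 * cv) * ∂t (∂x c)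
      + (-cw * cw) * ∂t (∂x (∂x c))
      + (-cu * cw - cv) * ∂t (∂x (∂x (∂x c))) := by
  rw [eulerTwo_add, eulerTwo_sub]
  simp [eulerTwo, eqQ, pd_mul, pd_co, hg.p, hg.q, hg.r, hg.v, hg.w, T₂_mul, X₂_mul, X₂_co, T₂_co,
    hg.T₂_eq, hg.X₂_eq, (hg.pd _).T₂_eq, (hg.pd _).X₂_eq, ((hg.pd _).pd _).T₂_eq,
    ((hg.pd _).pd _).X₂_eq, hc.p, hc.q, hc.r, hc.v, hc.w, hc.u, (hc.pd _).p, (hc.pd _).q,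
    (hc.pd _).r, (hc.pd _).v, (hc.pd _).w, (hc.pd _).u, hc.T₂_eq, hc.X₂_eq, (hc.pd _).T₂_eq,
    (hc.pd _).X₂_eq, ((hc.pd _).pd _).T₂_eq, ((hc.pd _).pd _).X₂_eq,
    (((hc.pd _).pd _).pd _).T₂_eq, (((hc.pd _).pd _).pd _).X₂_eq,
    pd_comm x t, pd_comm (u 0 0) t, pd_comm (u 0 0) x, map_ofNat_eq_zero, -Derivation.leibniz]
  ring

/-- Coefficients are read off in turn: `rw²` gives `c_x = 0`, `rv` gives `g_uu = -12uc`, `q` gives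
`g_xu = 0`, and `r` gives `hr'`. -/
theorem ansatz_of_eulerTwo_eq_zero {c g : DiffFun} (hc : OnlyTX c) (hg : OnlyTXU g)
    (h : eulerTwo (c * (2 * (cq + cu * cr) + cw * cw) - ∂x c * (cv + cu * cw) + g) = 0) :
    ∂x c = 0 ∧ ∂t c = 0 ∧ ∂x g = 0 ∧ ∂t g = 0 ∧ ∂u (∂u g) = -(12 * (cu * c)) := by
  rw [eulerTwo_ansatz hc hg] at h
  have hx : ∂x c = 0 := by
    have h₁ := congrArg ∂w (congrArg ∂w (congrArg ∂r h))
    simp [pd_mul, pd_co, pd_comm_normal, hc.r, hg.r, hc.w, hg.w,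
      map_ofNat_eq_zero, -Derivation.leibniz] at h₁
    refine eq_zero_of_ofNat_mul (n := 2) ?_
    linear_combination h₁
  simp only [hx, map_zero, mul_zero, add_zero, pd_comm x t] at h
  have huu : ∂u (∂u g) = -(12 * (cu * c)) := by
    have h₁ := congrArg ∂v (congrArg ∂r h)
    simp [pd_mul, pd_co, pd_comm_normal, hc.r, hg.r, hc.v, hg.v, (hg.pd _).v, ((hg.pd _).pd _).v, (((hg.pd _).pd _).pd _).v,
      map_ofNat_eq_zero, -Derivation.leibniz] at h₁
    linear_combination h₁
  have hxu : ∂x (∂u g) = 0 := by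
    have h₁ := congrArg ∂q h
    simp [pd_mul, pd_co, pd_comm_normal, hc.q, hc.u, hg.q, (hg.pd _).q, ((hg.pd _).pd _).q, (((hg.pd _).pd _).pd _).q, huu,
      map_ofNat_eq_zero, -Derivation.leibniz] at h₁
    refine eq_zero_of_ofNat_mul (n := 2) ?_
    linear_combination h₁
  have hr := congrArg ∂r h
  have htuu : ∂t (∂u (∂u g)) = -(12 * (cu * ∂t c)) := by
    rw [huu]
    simp [pd_mul, pd_co, 
      map_ofNat_eq_zero, -Derivation.leibniz]
  have hxuu : ∂x (∂u (∂u g)) = 0 := by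
    rw [huu]
    simp [pd_mul, pd_co, map_ofNat_eq_zero, hx, -Derivation.leibniz]
  have huuu : ∂u (∂u (∂u g)) = -(12 * c) := by
    rw [huu]
    simp [pd_mul, pd_co, map_ofNat_eq_zero, hc.u, -Derivation.leibniz]
  have hr' : ∂x g + ∂t (∂u g) + (6 * (cu * cu) - 2 * cu) * ∂t c = 0 := by
    simp [pd_mul, pd_co, pd_comm_normal, hc.r, hg.r, huu, hxu,
      map_ofNat_eq_zero, -Derivation.leibniz] at hr
    linear_combination hr
  -- In the `u`-derivative of `hr'`, `g_xu = 0` and `g_tuu = -12u c_t`, leaving `-2c_t`.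
  have ht : ∂t c = 0 := by
    have h₁ := congrArg ∂u hr'
    simp [pd_mul, pd_co, (hc.pd _).u, pd_comm (u 0 0) t, pd_comm (u 0 0) x, hxu, htuu,
      map_ofNat_eq_zero, -Derivation.leibniz] at h₁
    refine eq_zero_of_ofNat_mul (n := 2) ?_
    linear_combination -h₁
  rw [ht, mul_zero, add_zero] at hr'
  simp only [hxu, hxuu, htuu, huuu, ht, map_zero, mul_zero, add_zero, pd_comm x t] at h
  simp only [huu] at h
  have h' : -(3 * (cu * cu * ∂x g)) + cw * ∂x (∂x g) + cu * ∂x (∂x (∂x g)) - ∂t g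
      + ∂t (∂x (∂x g)) = 0 := by
    linear_combination h - cr * hr'
  have h₁ := congrArg ∂u h'
  simp [pd_mul, pd_co, pd_comm (u 0 0) t, pd_comm (u 0 0) x, hxu,
      map_ofNat_eq_zero, -Derivation.leibniz] at h₁
  -- Two `u`-derivatives of the remainder `h'` leave only `-6 g_x`.
  have hgx : ∂x g = 0 := by
    have h₂ := congrArg ∂u h₁
    simp [pd_mul, pd_co, pd_comm (u 0 0) t, pd_comm (u 0 0) x, hxu, htuu, ht,
      map_ofNat_eq_zero, -Derivation.leibniz] at h₂
    refine eq_zero_of_ofNat_mul (n := 6) ?_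
    linear_combination h₂
  refine ⟨hx, ht, hgx, ?_, huu⟩
  simp only [hgx, map_zero, mul_zero, add_zero, neg_zero, zero_sub, neg_eq_zero] at h'
  exact h'

theorem ord_co_two (i j : ℕ) (h : i + j ≤ 2) : Ord 2 (co (u i j)) :=
  ord_co (mem_coordsUpTo_u.2 h)

theorem ord_ofNat (m n : ℕ) [n.AtLeastTwo] : Ord m (ofNat(n) : DiffFun) := by
  have h := ord_algebraMap m (ofNat(n) : ℝ)
  rwa [map_ofNat] at h

theorem eq_algebraMap_of_onlyT {f : DiffFun} (hf : Ord 2 f) (h : OnlyT f) (ht : ∂t f = 0) :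
    ∃ c : ℝ, f = algebraMap ℝ DiffFun c := by
  refine eq_algebraMap_of_pd_eq_zero ?_
  rintro (_ | _ | ⟨i, j⟩)
  · exact ht
  · exact h.x
  · by_cases hij : 2 < i + j
    · exact hf.pd_eq_zero hij
    · have : i = 0 ∧ j = 0 ∨ i = 1 ∧ j = 0 ∨ i = 0 ∧ j = 1 ∨ i = 2 ∧ j = 0 ∨ i = 1 ∧ j = 1 ∨
          i = 0 ∧ j = 2 := by omega
      rcases this with ⟨rfl, rfl⟩ | ⟨rfl, rfl⟩ | ⟨rfl, rfl⟩ | ⟨rfl, rfl⟩ | ⟨rfl, rfl⟩ | ⟨rfl, rfl⟩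
      exacts [h.u, h.v, h.w, h.p, h.q, h.r]

/-- The general form of a differential function `φ` of order two with `E_u (φ F) = 0`, before the
dependence on `t` and `x` is excluded. -/
theorem exists_ansatz {φ : DiffFun} (hφ : Ord 2 φ) (hE : eulerSum 4 (φ * eqDF) = 0) :
    ∃ c g : DiffFun, Ord 2 c ∧ Ord 2 g ∧ OnlyTX c ∧ OnlyTXU g ∧
      φ + φ = c * (2 * (cq + cu * cr) + cw * cw) - ∂x c * (cv + cu * cw) + g := by
  obtain ⟨hpp, hpr, hqr, e₁, e₂, e₃, e₄⟩ := second_order_equations hφ hE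
  obtain ⟨aq, av, au, aw, ax⟩ := pd_eq_zero_of_X₂_eq hpr e₁
  rw [aq, mul_zero] at hpr
  have ha : OnlyT (∂p φ) := ⟨⟨hpp, aq, hpr, av, aw, au⟩, ax⟩
  rw [hpr, ha.T₂_eq, ha.X₂_eq, ax] at e₂
  rw [hqr, hpr, ha.T₂_eq] at e₃
  have e₂' : eqQ * ∂q (∂q φ) - ∂t (∂p φ) + X₂ (∂q φ) - cw * ∂p φ + 2 * ∂v φ = 0 := by
    linear_combination e₂
  -- Subtracting `u` times `e₂'` removes `Q`, `T₂` and `X₂` together.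
  have e₃' : ∂w φ = cu * ∂v φ + cw * ∂q φ + cv * ∂p φ - cu * cw * ∂p φ := by
    linear_combination e₃ - cu * e₂'
  have hcp : ∂p (∂q φ) = 0 := by rw [pd_comm, aq]
  have hcr : ∂r (∂q φ) = cu * ∂q (∂q φ) := by
    rw [pd_comm, hqr, hpr]
    ring
  obtain ⟨hm, hv, hw, hu⟩ := pd_q_of_equations ha hcp hcr (pd_comm _ _ _) (pd_comm _ _ _)
    (pd_comm _ _ _) e₂' e₃'
  obtain ⟨ha₀, hm₀⟩ := eq_zero_of_pd_p_eulerTwo ha hm hv hw hu e₂' hcr (eulerTwo_eq_zero hφ hE)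
  rw [hm₀, mul_zero] at hcr hw
  rw [hm₀, ha₀, mul_zero, sub_zero] at hu
  have hc : OnlyTX (∂q φ) := ⟨hcp, hm₀, hcr, hv, hw, hu⟩
  have hf : 2 * ∂v φ = -∂x (∂q φ) := by
    rw [hm₀, ha₀, hc.X₂_eq, map_zero] at e₂'
    linear_combination e₂'
  have hh : ∂w φ = cu * ∂v φ + cw * ∂q φ := by
    rw [ha₀] at e₃'
    linear_combination e₃'
  have hrv : ∂r (∂v φ) = 0 := by
    have h := congrArg ∂r hf
    rw [map_neg, (hc.pd x).r, neg_zero, pd_mul, map_ofNat_eq_zero, mul_zero, add_zero] at h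
    exact eq_zero_of_ofNat_mul h
  have hrw : ∂r (∂w φ) = 0 := by
    rw [hh]
    simp [pd_mul, pd_co, hrv, hcr, -Derivation.leibniz]
  have hd := eq_mul_of_pd_r_equation hc (by rw [pd_comm, hrv]) (by rw [pd_comm, hrw]) hf hh e₄
  have o₂ : Ord 2 (2 : DiffFun) := ord_ofNat 2 2
  have ow := ord_co_two 0 1 (by omega)
  have ou := ord_co_two 0 0 (by omega)
  -- Taking `2φ` avoids halves: `∂v φ` is known through `2 ∂v φ = -∂x (∂q φ)`.
  refine ⟨∂q φ, φ + φ - (∂q φ * (2 * (cq + cu * cr) + cw * cw) - ∂x (∂q φ) * (cv + cu * cw)),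
    hφ.pd _, ?_, hc, ?_, by ring⟩
  · exact (hφ.add hφ).sub (((hφ.pd _).mul ((o₂.mul ((ord_co_two 1 1 (by omega)).add
      (ou.mul (ord_co_two 0 2 (by omega))))).add (ow.mul ow))).sub
      (((hφ.pd _).pd _).mul ((ord_co_two 1 0 (by omega)).add (ou.mul ow))))
  · constructor <;>
      simp [pd_mul, pd_co, map_ofNat_eq_zero, hc.p, hc.q, hc.r, hc.v, hc.w, (hc.pd x).p,
        (hc.pd x).q, (hc.pd x).r, (hc.pd x).v, (hc.pd x).w, ha₀, hd, hh, -Derivation.leibniz]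
    · ring
    · ring
    · linear_combination hf
    · linear_combination cu * hf

/-- A differential function `φ` of order two with `E_u (φ F) = 0` is a characteristic. -/
theorem exists_eq_charac {φ : DiffFun} (hφ : Ord 2 φ) (hE : eulerSum 4 (φ * eqDF) = 0) :
    ∃ c₁ c₂ c₃ : ℝ, φ.toFun = charac c₁ c₂ c₃ := by
  obtain ⟨c, g, oc, og, hc, hg, h⟩ := exists_ansatz hφ hE
  have hz : eulerTwo (φ + φ) = 0 := by
    rw [eulerTwo_add, eulerTwo_eq_zero hφ hE, add_zero]
  rw [h] at hz
  obtain ⟨hcx, hct, hgx, hgt, hguu⟩ := ansatz_of_eulerTwo_eq_zero hc hg hz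
  obtain ⟨κ, rfl⟩ := eq_algebraMap_of_onlyT oc ⟨hc, hcx⟩ hct
  have ou := ord_co_two 0 0 (by omega)
  have hgxu : ∂x (∂u g) = 0 := by rw [pd_comm, hgx, map_zero]
  have hgtu : ∂t (∂u g) = 0 := by rw [pd_comm, hgt, map_zero]
  -- Integrating `g_uu = -12κu` twice: `g_u = β - 6κu²`, then `g = α + βu - 2κu³`.
  obtain ⟨β, hβ⟩ := eq_algebraMap_of_onlyT (f := ∂u g + 6 * (cu * cu * algebraMap ℝ DiffFun κ))
    ((og.pd _).add ((ord_ofNat 2 6).mul ((ou.mul ou).mul oc)))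
    (by
      constructor
      · constructor <;>
          simp [pd_mul, pd_co, map_ofNat_eq_zero, (hg.pd (u 0 0)).p, (hg.pd (u 0 0)).q,
            (hg.pd (u 0 0)).r, (hg.pd (u 0 0)).v, (hg.pd (u 0 0)).w, hguu, -Derivation.leibniz]
        ring
      · simp [pd_mul, pd_co, map_ofNat_eq_zero, hgxu, -Derivation.leibniz])
    (by simp [pd_mul, pd_co, map_ofNat_eq_zero, hgtu, -Derivation.leibniz])
  obtain ⟨α, hα⟩ := eq_algebraMap_of_onlyT
    (f := g - cu * algebraMap ℝ DiffFun β + 2 * (cu * cu * cu * algebraMap ℝ DiffFun κ))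
    ((og.sub (ou.mul (ord_algebraMap 2 β))).add ((ord_ofNat 2 2).mul (((ou.mul ou).mul ou).mul oc)))
    (by
      constructor
      · constructor <;>
          simp [pd_mul, pd_co, map_ofNat_eq_zero, hg.p, hg.q, hg.r, hg.v, hg.w,
            -Derivation.leibniz]
        linear_combination hβ
      · simp [pd_mul, pd_co, map_ofNat_eq_zero, hgx, -Derivation.leibniz])
    (by simp [pd_mul, pd_co, map_ofNat_eq_zero, hgt, -Derivation.leibniz])
  refine ⟨α / 2, β / 2, -κ, funext fun z => ?_⟩
  have h₁ := congrArg (ev z) h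
  have h₂ := congrArg (ev z) hα
  simp only [map_add, map_sub, map_mul, ev_co, AlgHom.commutes, Algebra.algebraMap_self, map_ofNat,
    RingHom.id_apply, Derivation.map_algebraMap, map_zero] at h₁ h₂
  rw [toFun_apply, charac]
  linear_combination h₁ / 2 + h₂ / 2

/-! ### Jets on the solutions with prescribed third-order part -/

/-- The function depends only on `t`, `x` and the coordinates `u i j` with `i ≤ n`. -/
def RowsLE (n : ℕ) (f : DiffFun) : Prop :=
  ∀ y z : Jet, y t = z t → y x = z x → (∀ i j, i ≤ n → y (u i j) = z (u i j)) → ev y f = ev z f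

theorem RowsLE.mono {m n : ℕ} (h : m ≤ n) {f : DiffFun} (hf : RowsLE m f) : RowsLE n f :=
  fun y z ht hx hu => hf y z ht hx fun i j hi => hu i j (hi.trans h)

theorem RowsLE.add {n : ℕ} {f g : DiffFun} (hf : RowsLE n f) (hg : RowsLE n g) :
    RowsLE n (f + g) := fun y z ht hx hu => by
  rw [map_add, map_add, hf y z ht hx hu, hg y z ht hx hu]

theorem RowsLE.mul {n : ℕ} {f g : DiffFun} (hf : RowsLE n f) (hg : RowsLE n g) :
    RowsLE n (f * g) := fun y z ht hx hu => by
  rw [map_mul, map_mul, hf y z ht hx hu, hg y z ht hx hu]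

theorem RowsLE.sum {n : ℕ} {ι : Type*} {s : Finset ι} {f : ι → DiffFun}
    (hf : ∀ i ∈ s, RowsLE n (f i)) : RowsLE n (∑ i ∈ s, f i) := fun y z ht hx hu => by
  rw [map_sum, map_sum]
  exact Finset.sum_congr rfl fun i hi => hf i hi y z ht hx hu

theorem rowsLE_co {n i : ℕ} (h : i ≤ n) (j : ℕ) : RowsLE n (co (u i j)) :=
  fun _ _ _ _ hu => hu i j h

theorem rowsLE_zero (n : ℕ) : RowsLE n 0 := fun _ _ _ _ _ => rfl

theorem RowsLE.ev_update {n : ℕ} {f : DiffFun} (hf : RowsLE n f) {y z : Jet} (ht : y t = z t)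
    (hx : y x = z x) (hu : ∀ i j, i ≤ n → y (u i j) = z (u i j)) (k : JetCoord) (s : ℝ) :
    ev (Function.update y k s) f = ev (Function.update z k s) f := by
  have h : ∀ l, y l = z l → Function.update y k s l = Function.update z k s l := fun l hl => by
    by_cases h : l = k
    · subst h
      simp
    · simp [h, hl]
  exact hf _ _ (h _ ht) (h _ hx) fun i j hi => h _ (hu i j hi)

theorem RowsLE.pd_eq_zero {n : ℕ} {f : DiffFun} (hf : RowsLE n f) {i j : ℕ} (hi : n < i) :
    pd (u i j) f = 0 := by
  refine ext_ev fun z => ?_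
  have h : (fun s : ℝ => f.toFun (Function.update z (u i j) s)) = fun _ => ev z f := by
    ext s
    refine hf _ _ (by simp) (by simp) fun a b hab => Function.update_of_ne ?_ _ _
    intro h
    rw [u.injEq] at h
    omega
  change deriv (fun s : ℝ => f.toFun (Function.update z (u i j) s)) _ = _
  rw [h, deriv_const, map_zero]

theorem RowsLE.pd {n : ℕ} {f : DiffFun} (hf : RowsLE n f) (k : JetCoord) :
    RowsLE n (pd k f) := by
  intro y z ht hx hu
  by_cases hk : y k = z k
  · change deriv (fun s : ℝ => ev (Function.update y k s) f) (y k)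
      = deriv (fun s : ℝ => ev (Function.update z k s) f) (z k)
    simp only [hf.ev_update ht hx hu, hk]
  · rcases k with _ | _ | ⟨i, j⟩
    · exact absurd ht hk
    · exact absurd hx hk
    · rw [hf.pd_eq_zero (not_le.1 fun hi => hk (hu i j hi)), map_zero, map_zero]

theorem RowsLE.D {n : ℕ} {f : DiffFun} (hf : RowsLE n f) (k : JetCoord) (a b : ℕ) :
    RowsLE (n + a) (D k a b f) := by
  obtain ⟨m, hm⟩ := f.exists_order
  rw [D_eq_truncD k a b (f := f) hm (Nat.lt_succ_self m), truncD_apply]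
  refine ((hf.pd k).mono (by omega)).add (RowsLE.sum fun i _ => RowsLE.sum fun j _ => ?_)
  by_cases hi : n < i
  · rw [hf.pd_eq_zero hi, mul_zero]
    exact rowsLE_zero _
  · exact (rowsLE_co (by omega) _).mul ((hf.pd _).mono (by omega))

/-- The part of `F` without derivatives with respect to `t`. -/
noncomputable def eqG : DiffFun :=
  -1 * (co (u 0 0) * co (u 0 3)) + -2 * (co (u 0 1) * co (u 0 2))
    + 3 * (co (u 0 0) * co (u 0 0) * co (u 0 1))

/-- Only `D_t` raises the row index, so the equations for row `i + 1` have inhomogeneities known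
from rows up to `i`; this makes the recursion for solution jets possible. -/
theorem rowsLE_iterate_eqG (i j : ℕ) : RowsLE i (T^[i] (X^[j] eqG)) := by
  have h : ∀ c : DiffFun, (∀ y z, ev y c = ev z c) → RowsLE 0 c := fun c hc y z _ _ _ => hc y z
  have hG : RowsLE 0 eqG := by
    refine (((h _ fun y z => ?_).mul ((rowsLE_co le_rfl 0).mul (rowsLE_co le_rfl 3))).add
      ((h _ fun y z => ?_).mul ((rowsLE_co le_rfl 1).mul (rowsLE_co le_rfl 2)))).add
      ((h _ fun y z => ?_).mul (((rowsLE_co le_rfl 0).mul (rowsLE_co le_rfl 0)).mul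
        (rowsLE_co le_rfl 1)))
    · simp
    · simp [map_ofNat]
    · simp [map_ofNat]
  have hX : RowsLE 0 (X^[j] eqG) := by
    induction j with
    | zero => exact hG
    | succ j ih =>
      rw [Function.iterate_succ_apply']
      exact ih.D x 0 1
  induction i with
  | zero => exact hX
  | succ i ih =>
    rw [Function.iterate_succ_apply']
    exact ih.D t 1 0

theorem iterate_eqDF (i j : ℕ) : T^[i] (X^[j] eqDF)
    = co (u (i + 1) j) - co (u (i + 1) (j + 2)) + T^[i] (X^[j] eqG) := by
  have hX : X^[j] eqDF = co (u 1 j) - co (u 1 (j + 2)) + X^[j] eqG := by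
    induction j with
    | zero =>
      change eqDF = co (u 1 0) - co (u 1 2) + eqG
      unfold eqDF eqQ eqG
      ring
    | succ j ih => simp only [Function.iterate_succ_apply', ih, map_add, map_sub, X_co]
  induction i with
  | zero => exact hX
  | succ i ih => simp only [Function.iterate_succ_apply', ih, map_add, map_sub, T_co]

theorem onSolutions_eqF {z : Jet} (h : ∀ i j, ev z (T^[i] (X^[j] eqDF)) = 0) :
    OnSolutions eqF z := by
  intro i j
  have hT : Function.Semiconj toFun T Dt := toFun_T
  have hX : Function.Semiconj toFun X Dx := toFun_X
  rw [← toFun_eqDF, ← (hX.iterate_right j) eqDF, ← (hT.iterate_right i)]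
  exact h i j

/-- The values of the coordinates `u (i + 1) j`, determined by the equation from the values for
`j = 0, 1` and the coordinates `u a b` with `a ≤ i`. -/
noncomputable def solutionRow (y : Jet) (i : ℕ) : ℕ → ℝ
  | 0 => y (u (i + 1) 0)
  | 1 => y (u (i + 1) 1)
  | j + 2 => solutionRow y i j + ev y (T^[i] (X^[j] eqG))

/-- The jet `z`, modified in the coordinates `u i j` with `1 ≤ i ≤ n` so that the equation holds
there. -/
noncomputable def partialSolution (z : Jet) : ℕ → Jet
  | 0 => z
  | n + 1 => fun k => match k with
    | u i j => if i = n + 1 then solutionRow (partialSolution z n) n j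
        else partialSolution z n (u i j)
    | k => z k

/-- The jet on the solutions with the same parametric coordinates as `z`. -/
noncomputable def solutionJet (z : Jet) : Jet := fun k => match k with
  | u i j => partialSolution z i (u i j)
  | k => z k

theorem partialSolution_of_lt (z : Jet) {n i : ℕ} (h : n < i) (j : ℕ) :
    partialSolution z n (u i j) = z (u i j) := by
  induction n with
  | zero => rfl
  | succ n ih =>
    simp only [partialSolution]
    rw [if_neg (by omega), ih (by omega)]

theorem partialSolution_of_le (z : Jet) {n i : ℕ} (h : i ≤ n) (j : ℕ) :
    partialSolution z n (u i j) = solutionJet z (u i j) := by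
  induction n with
  | zero =>
    obtain rfl : i = 0 := by omega
    rfl
  | succ n ih =>
    rcases Nat.lt_or_ge n i with hi | hi
    · obtain rfl : i = n + 1 := by omega
      rfl
    · simp only [partialSolution]
      rw [if_neg (by omega), ih hi]

theorem partialSolution_indep (z : Jet) (n : ℕ) :
    partialSolution z n t = z t ∧ partialSolution z n x = z x := by
  cases n <;> exact ⟨rfl, rfl⟩

theorem solutionJet_succ (z : Jet) (i j : ℕ) :
    solutionJet z (u (i + 1) j) = solutionRow (partialSolution z i) i j := by
  simp only [solutionJet, partialSolution, if_true]

theorem onSolutions_solutionJet (z : Jet) : OnSolutions eqF (solutionJet z) := by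
  refine onSolutions_eqF fun i j => ?_
  have h : ev (partialSolution z i) (T^[i] (X^[j] eqG))
      = ev (solutionJet z) (T^[i] (X^[j] eqG)) :=
    rowsLE_iterate_eqG i j _ _ (partialSolution_indep z i).1 (partialSolution_indep z i).2
      fun a b ha => partialSolution_of_le z ha b
  rw [iterate_eqDF, map_add, map_sub, ev_co, ev_co, solutionJet_succ, solutionJet_succ,
    solutionRow, h]
  ring

/-- Up to order three the recursion overwrites only `u_txx`, and the value it assigns is the one
forced by `F = 0`. -/
theorem solutionJet_eq {z : Jet} (hz : eqF z = 0) {k : JetCoord} (hk : k ∈ coordsUpTo 3) :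
    solutionJet z k = z k := by
  rcases k with _ | _ | ⟨i, j⟩
  · rfl
  · rfl
  · rw [mem_coordsUpTo_u] at hk
    cases i with
    | zero => rfl
    | succ i =>
      rw [solutionJet_succ]
      rcases j with _ | _ | j
      · exact partialSolution_of_lt z (Nat.lt_succ_self i) 0
      · exact partialSolution_of_lt z (Nat.lt_succ_self i) 1
      · obtain rfl : i = 0 := by omega
        obtain rfl : j = 0 := by omega
        simp only [solutionRow, partialSolution, Function.iterate_zero, id_eq, eqG, map_add,
          map_mul, map_neg, map_one, map_ofNat, ev_co, zero_add]
        simp only [eqF] at hz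
        linear_combination hz

/-! ### Divergences vanishing on the solutions -/

/-- If `T A + X B` vanishes on the solutions, it is a multiple of `F`. -/
theorem div_eq_mul_eqDF {A B : DiffFun} (hA : Ord 2 A) (hB : Ord 2 B)
    (h : ∀ z, OnSolutions eqF z → ev z (T A + X B) = 0) :
    T A + X B = -(pd (u 0 2) A + pd (u 1 1) B) * eqDF := by
  refine ext_ev fun z => ?_
  have hF : ∀ y, ev y eqDF = eqF y := fun y => congrFun toFun_eqDF y
  -- `F` contains `-u_txx`, so this shift gives `F(y) = 0`. The divergence is affine in `u_txx` with
  -- coefficient `A_r + B_q`, so it changes by `(A_r + B_q) F(z)`.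
  set y : Jet := Function.update z (u 1 2) (z (u 1 2) + eqF z) with hy
  have hyk : ∀ k, k ≠ u 1 2 → y k = z k := fun k hk => Function.update_of_ne hk _ _
  have hy12 : y (u 1 2) = z (u 1 2) + eqF z := Function.update_self _ _ _
  have hy₀ : eqF y = 0 := by
    simp only [eqF, hyk _ (show u 1 0 ≠ u 1 2 by simp), hyk _ (show u 0 0 ≠ u 1 2 by simp),
      hyk _ (show u 0 1 ≠ u 1 2 by simp), hyk _ (show u 0 2 ≠ u 1 2 by simp),
      hyk _ (show u 0 3 ≠ u 1 2 by simp), hy12]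
    ring
  have h₀ : ev y (T A + X B) = 0 := by
    rw [← h _ (onSolutions_solutionJet y)]
    exact (hA.T.add hB.X).congr_jet fun k hk => (solutionJet_eq hy₀ hk).symm
  have h₂ : ∀ {f}, Ord 2 f → ev y f = ev z f := fun hf => hf.congr_jet fun k hk => hyk k fun e => by
    rw [e, mem_coordsUpTo_u] at hk
    omega
  rw [T_of_ord_two hA, X_of_ord_two hB] at h₀ ⊢
  simp only [map_add, map_mul, map_neg, ev_co, hF, h₂ (hA.pd _), h₂ (hB.pd _), ne_eq, u.injEq,
    hyk (u _ _), hy12, OfNat.one_ne_ofNat, OfNat.ofNat_ne_one,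
    OfNat.zero_ne_ofNat, zero_ne_one, and_false, false_and,
    and_self, not_false_eq_true, Nat.reduceEqDiff] at h₀ ⊢
  linear_combination h₀

/-! ### The three currents and the correspondence with characteristics -/

/-- The pair of functions underlying a pair of differential functions. -/
def toCurrent (A B : DiffFun) : Current := (A.toFun, B.toFun)

theorem totalDiv_toCurrent (A B : DiffFun) : totalDiv (toCurrent A B) = (T A + X B).toFun := rfl

theorem exists_eq_toCurrent {C : Current} (hC : C.HasOrderLE 2) :
    ∃ A B : DiffFun, Ord 2 A ∧ Ord 2 B ∧ C = toCurrent A B :=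
  ⟨mk C.1 hC.1, mk C.2 hC.2, hC.1, hC.2, rfl⟩

theorem hasOrderLE_toCurrent {A B : DiffFun} (hA : Ord 2 A) (hB : Ord 2 B) :
    (toCurrent A B).HasOrderLE 2 := ⟨hA, hB⟩

theorem exists_toCurrent_eq_current1 : ∃ A B : DiffFun, Ord 2 A ∧ Ord 2 B ∧
    current1 = toCurrent A B ∧ (T A + X B).toFun = charac 1 0 0 * eqF := by
  have o : ∀ i j, i + j ≤ 2 → Ord 2 (co (u i j)) := fun i j h => ord_co_two i j h
  have o00 := o 0 0 (by omega)
  have o01 := o 0 1 (by omega)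
  have o02 := o 0 2 (by omega)
  refine ⟨co (u 0 0) - co (u 0 2), co (u 0 0) * (co (u 0 0) * co (u 0 0))
    - (1 / 2 : ℝ) • (co (u 0 1) * co (u 0 1)) - co (u 0 0) * co (u 0 2), o00.sub o02,
    ((o00.mul (o00.mul o00)).sub ((o01.mul o01).smul _)).sub (o00.mul o02), ?_, ?_⟩
  · refine Prod.ext (funext fun z => ?_) (funext fun z => ?_) <;>
      simp [toCurrent, current1, toFun_apply]
    ring
  · ext z
    simp [toFun_apply, charac, eqF, X_mul, -Derivation.leibniz]
    ring

theorem exists_toCurrent_eq_current2 : ∃ A B : DiffFun, Ord 2 A ∧ Ord 2 B ∧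
    current2 = toCurrent A B ∧ (T A + X B).toFun = charac 0 1 0 * eqF := by
  have o : ∀ i j, i + j ≤ 2 → Ord 2 (co (u i j)) := fun i j h => ord_co_two i j h
  have o00 := o 0 0 (by omega)
  have o01 := o 0 1 (by omega)
  have o02 := o 0 2 (by omega)
  have o11 := o 1 1 (by omega)
  have os := o00.mul o00
  refine ⟨(1 / 2 : ℝ) • (co (u 0 0) * co (u 0 0) + co (u 0 1) * co (u 0 1)),
    (3 / 4 : ℝ) • ((co (u 0 0) * co (u 0 0)) * (co (u 0 0) * co (u 0 0)))
      - co (u 0 0) * co (u 1 1) - (co (u 0 0) * co (u 0 0)) * co (u 0 2),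
    (os.add (o01.mul o01)).smul _,
    (((os.mul os).smul _).sub (o00.mul o11)).sub (os.mul o02), ?_, ?_⟩
  · refine Prod.ext (funext fun z => ?_) (funext fun z => ?_) <;>
      simp [toCurrent, current2, toFun_apply] <;> ring
  · ext z
    simp [toFun_apply, charac, eqF, T_mul, X_mul, -Derivation.leibniz]
    ring

theorem exists_toCurrent_eq_current3 : ∃ A B : DiffFun, Ord 2 A ∧ Ord 2 B ∧
    current3 = toCurrent A B ∧ (T A + X B).toFun = charac 0 0 1 * eqF := by
  have o : ∀ i j, i + j ≤ 2 → Ord 2 (co (u i j)) := fun i j h => ord_co_two i j h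
  have o00 := o 0 0 (by omega)
  have o10 := o 1 0 (by omega)
  have o01 := o 0 1 (by omega)
  have o02 := o 0 2 (by omega)
  have o11 := o 1 1 (by omega)
  have os := o00.mul o00
  have ow := o01.mul o01
  refine ⟨(1 / 4 : ℝ) • ((co (u 0 0) * co (u 0 0)) * (co (u 0 0) * co (u 0 0)))
      + (1 / 2 : ℝ) • (co (u 0 0) * (co (u 0 1) * co (u 0 1))),
    (1 / 2 : ℝ) • ((co (u 0 0) * co (u 0 0)) * ((co (u 0 0) * co (u 0 0))
        * (co (u 0 0) * co (u 0 0))))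
      + (1 / 8 : ℝ) • ((co (u 0 1) * co (u 0 1)) * (co (u 0 1) * co (u 0 1)))
      - (1 / 2 : ℝ) • (co (u 1 0) * co (u 1 0))
      - co (u 0 0) * (co (u 1 0) * co (u 0 1))
      - (1 / 2 : ℝ) • (co (u 0 0) * (co (u 0 0) * co (u 0 0)) * (co (u 0 1) * co (u 0 1)))
      + (1 / 2 : ℝ) • (co (u 0 0) * (co (u 0 1) * co (u 0 1)) * co (u 0 2))
      + (1 / 2 : ℝ) • (co (u 0 1) * co (u 0 1) * co (u 1 1))
      + (1 / 2 : ℝ) • (co (u 1 1) * co (u 1 1))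
      + (1 / 2 : ℝ) • (co (u 0 0) * co (u 0 0) * (co (u 0 2) * co (u 0 2)))
      - (co (u 0 0) * co (u 0 0)) * (co (u 0 0) * co (u 0 0)) * co (u 0 2)
      + co (u 0 0) * (co (u 0 2) * co (u 1 1))
      - co (u 0 0) * (co (u 0 0) * co (u 0 0)) * co (u 1 1),
    ((os.mul os).smul _).add ((o00.mul ow).smul _),
    (((((((((((((os.mul (os.mul os)).smul _).add ((ow.mul ow).smul _)).sub
      ((o10.mul o10).smul _)).sub (o00.mul (o10.mul o01))).sub
      (((o00.mul os).mul ow).smul _)).add (((o00.mul ow).mul o02).smul _)).add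
      ((ow.mul o11).smul _)).add ((o11.mul o11).smul _)).add
      ((os.mul (o02.mul o02)).smul _)).sub ((os.mul os).mul o02)).add
      (o00.mul (o02.mul o11))).sub ((o00.mul os).mul o11)), ?_, ?_⟩
  · refine Prod.ext (funext fun z => ?_) (funext fun z => ?_) <;>
      simp [toCurrent, current3, toFun_apply] <;> ring
  · ext z
    simp [toFun_apply, charac, eqF, T_mul, X_mul, -Derivation.leibniz]
    ring

theorem isConservedCurrent_toCurrent {A B : DiffFun} {φ : Jet → ℝ}
    (h : (T A + X B).toFun = φ * eqF) : IsConservedCurrent eqF (toCurrent A B) := by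
  refine ⟨A.exists_order, B.exists_order, fun z hz => ?_⟩
  have h₀ : eqF z = 0 := hz 0 0
  rw [totalDiv_toCurrent, h, Pi.mul_apply, h₀, mul_zero]

/-- A current differs from a linear combination of the three basic ones by a trivial current if and
only if its divergence is the corresponding multiple of `F`. -/
theorem isTrivialCurrent_sub_iff {C : Current} (hC : C.HasOrderLE 2) (c₁ c₂ c₃ : ℝ) :
    IsTrivialCurrent (C - (c₁ • current1 + c₂ • current2 + c₃ • current3))
      ↔ totalDiv C = charac c₁ c₂ c₃ * eqF := by
  obtain ⟨A, B, -, -, rfl⟩ := exists_eq_toCurrent hC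
  obtain ⟨A₁, B₁, -, -, e₁, h₁⟩ := exists_toCurrent_eq_current1
  obtain ⟨A₂, B₂, -, -, e₂, h₂⟩ := exists_toCurrent_eq_current2
  obtain ⟨A₃, B₃, -, -, e₃, h₃⟩ := exists_toCurrent_eq_current3
  have e : toCurrent A B - (c₁ • current1 + c₂ • current2 + c₃ • current3)
      = toCurrent (A - (c₁ • A₁ + c₂ • A₂ + c₃ • A₃)) (B - (c₁ • B₁ + c₂ • B₂ + c₃ • B₃)) := by
    rw [e₁, e₂, e₃]
    rfl
  have hd : ∀ z, totalDiv (toCurrent (A - (c₁ • A₁ + c₂ • A₂ + c₃ • A₃))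
      (B - (c₁ • B₁ + c₂ • B₂ + c₃ • B₃))) z
      = totalDiv (toCurrent A B) z - (charac c₁ c₂ c₃ * eqF) z := by
    intro z
    have h₁' := congrFun h₁ z
    have h₂' := congrFun h₂ z
    have h₃' := congrFun h₃ z
    simp only [totalDiv_toCurrent, toFun_apply, map_add, map_sub, Derivation.map_smul, map_smul,
      smul_eq_mul, Pi.mul_apply, charac] at h₁' h₂' h₃' ⊢
    linear_combination -c₁ * h₁' - c₂ * h₂' - c₃ * h₃'
  rw [e]
  constructor
  · rintro ⟨-, -, h⟩
    ext z
    exact sub_eq_zero.1 ((hd z).symm.trans (h z))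
  · intro h
    refine ⟨exists_order _, exists_order _, fun z => ?_⟩
    rw [hd, h, sub_self]

theorem euler_mul_eqF_eq_zero_iff {φ : Jet → ℝ} (hφ : CHCurrents.HasOrderLE 2 φ) :
    (∀ z, euler (φ * eqF) z = 0) ↔ ∃ c₁ c₂ c₃ : ℝ, φ = charac c₁ c₂ c₃ := by
  constructor
  · intro h
    have hL : Ord 3 (mk φ hφ * eqDF) := (show Ord 3 (mk φ hφ) from HasOrderLE.mono (by omega) hφ).mul ord_eqDF
    refine exists_eq_charac (φ := mk φ hφ) hφ (toFun_injective ?_)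
    rw [← euler_toFun hL (by omega), toFun_mul, toFun_mk, toFun_eqDF]
    exact funext h
  · rintro ⟨c₁, c₂, c₃, rfl⟩ z
    obtain ⟨A₁, B₁, -, -, -, h₁⟩ := exists_toCurrent_eq_current1
    obtain ⟨A₂, B₂, -, -, -, h₂⟩ := exists_toCurrent_eq_current2
    obtain ⟨A₃, B₃, -, -, -, h₃⟩ := exists_toCurrent_eq_current3
    have e : charac c₁ c₂ c₃ * eqF = (T (c₁ • A₁ + c₂ • A₂ + c₃ • A₃)
        + X (c₁ • B₁ + c₂ • B₂ + c₃ • B₃)).toFun := by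
      ext z
      have h₁' := congrFun h₁ z
      have h₂' := congrFun h₂ z
      have h₃' := congrFun h₃ z
      simp only [toFun_apply, map_add, Derivation.map_smul, map_smul,
        smul_eq_mul, Pi.mul_apply, charac] at h₁' h₂' h₃' ⊢
      linear_combination -c₁ * h₁' - c₂ * h₂' - c₃ * h₃'
    rw [e, euler_totalDiv]
    rfl

/-- The divergence is `φ F` with `φ` of order two, and `E_u` annihilates it as a divergence; the
classification of such `φ` applies. -/
theorem exists_totalDiv_eq_of_isConservedCurrent {C : Current} (hC : C.HasOrderLE 2)
    (h : IsConservedCurrent eqF C) : ∃ c₁ c₂ c₃ : ℝ, totalDiv C = charac c₁ c₂ c₃ * eqF := by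
  obtain ⟨A, B, hA, hB, rfl⟩ := exists_eq_toCurrent hC
  have hd := div_eq_mul_eqDF hA hB h.2.2
  have hφ : Ord 2 (-(pd (u 0 2) A + pd (u 1 1) B)) := ((hA.pd _).add (hB.pd _)).neg
  have hd' : (T A + X B).toFun = (-(pd (u 0 2) A + pd (u 1 1) B)).toFun * eqF := by
    rw [hd, toFun_mul, toFun_eqDF]
  obtain ⟨c₁, c₂, c₃, hc⟩ := (euler_mul_eqF_eq_zero_iff hφ).1 fun z => by
    rw [← hd', euler_totalDiv]
    rfl
  exact ⟨c₁, c₂, c₃, by rw [totalDiv_toCurrent, hd', hc]⟩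

end DiffFun
end CHCurrents

open CHCurrents in
/-- For `u_t - u_txx + 3u² u_x = u u_xxx + 2 u_x u_xx`:
the three explicit currents are conserved currents of order at most two;
a current of order at most two is conserved if and only if it is a linear combination of the three
up to a trivial current, and its divergence is then `charac c₁ c₂ c₃ * F`;
and the differential functions `φ` of order at most two with `E_u (φ F) = 0` are exactly the
`charac c₁ c₂ c₃`. -/
theorem theorem3p2 :
    (current1.HasOrderLE 2 ∧ IsConservedCurrent eqF current1) ∧
    (current2.HasOrderLE 2 ∧ IsConservedCurrent eqF current2) ∧
    (current3.HasOrderLE 2 ∧ IsConservedCurrent eqF current3) ∧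
    (∀ C : Current, C.HasOrderLE 2 →
      (IsConservedCurrent eqF C ↔
        ∃ c₁ c₂ c₃ : ℝ,
          IsTrivialCurrent (C - (c₁ • current1 + c₂ • current2 + c₃ • current3)))) ∧
    (∀ (C : Current) (c₁ c₂ c₃ : ℝ), C.HasOrderLE 2 →
      IsTrivialCurrent (C - (c₁ • current1 + c₂ • current2 + c₃ • current3)) →
        totalDiv C = charac c₁ c₂ c₃ * eqF) ∧
    (∀ φ : Jet → ℝ, HasOrderLE 2 φ →
      ((∀ z : Jet, euler (φ * eqF) z = 0) ↔
        ∃ c₁ c₂ c₃ : ℝ, φ = charac c₁ c₂ c₃)) := by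
  refine ⟨?_, ?_, ?_, fun C hC => ⟨fun h => ?_, ?_⟩, fun C c₁ c₂ c₃ hC h => ?_, fun φ hφ => ?_⟩
  · obtain ⟨A, B, hA, hB, e, h⟩ := DiffFun.exists_toCurrent_eq_current1
    rw [e]
    exact ⟨DiffFun.hasOrderLE_toCurrent hA hB, DiffFun.isConservedCurrent_toCurrent h⟩
  · obtain ⟨A, B, hA, hB, e, h⟩ := DiffFun.exists_toCurrent_eq_current2
    rw [e]
    exact ⟨DiffFun.hasOrderLE_toCurrent hA hB, DiffFun.isConservedCurrent_toCurrent h⟩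
  · obtain ⟨A, B, hA, hB, e, h⟩ := DiffFun.exists_toCurrent_eq_current3
    rw [e]
    exact ⟨DiffFun.hasOrderLE_toCurrent hA hB, DiffFun.isConservedCurrent_toCurrent h⟩
  · obtain ⟨c₁, c₂, c₃, h'⟩ := DiffFun.exists_totalDiv_eq_of_isConservedCurrent hC h
    exact ⟨c₁, c₂, c₃, (DiffFun.isTrivialCurrent_sub_iff hC c₁ c₂ c₃).2 h'⟩
  · rintro ⟨c₁, c₂, c₃, h⟩
    have h' := (DiffFun.isTrivialCurrent_sub_iff hC c₁ c₂ c₃).1 h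
    obtain ⟨A, B, -, -, rfl⟩ := DiffFun.exists_eq_toCurrent hC
    exact DiffFun.isConservedCurrent_toCurrent h'
  · exact (DiffFun.isTrivialCurrent_sub_iff hC c₁ c₂ c₃).1 h
  · exact DiffFun.euler_mul_eqF_eq_zero_iff hφ
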